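/- Let $n\ge 1$ and $\mathcal H=L^2(\mathbb R^n)$ with canonical observables $R=(Q_1,P_1,\dots,Q_n,P_n)$ and Weyl operators $V(z)=\exp\bigl[i\sum_{j}(q_jP_j-p_jQ_j)\bigr]$, $z=(q_1,p_1,\dots,q_n,p_n)\in\mathbb R^{2n}$. A state is a positive operator $\rho$ on $\mathcal H$ with $\operatorname{Tr}\rho=1$; its characteristic function is $\chi_\rho(z)=\operatorname{Tr}(\rho V(z))$, and its Wigner function is $u\mapsto(2\pi)^{-n}\int_{\mathbb R^{2n}}e^{-i(u,z)}\chi_\rho(z)\,dz$. A Schwartz state is a state whose characteristic function is a Schwartz function on $\mathbb R^{2n}$. The quantum diffusion semigroup $(\Lambda_t)_{t\ge0}$ is the strongly continuous semigroup of linear, completely positive, trace-preserving maps on the trace class operators on $\mathcal H$ whose generator extends $$\mathcal L(X)=-\frac14\sum_{j=1}^{2n}[R_j,[R_j,X]],\qquad X\in\operatorname{span}\Bigl\{|\varphi\rangle\langle\psi| : \varphi,\psi\in\bigcap_{j=1}^{2n}\operatorname{dom}(R_j^2)\Bigr\}.$$ Write $\|A\|_2=(\operatorname{Tr}|A|^2)^{1/2}$,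 $\|A\|_\infty$ for the operator norm, and $S(\rho)=-\operatorname{Tr}(\rho\ln\rho)$. **Theorem (non-commutative ultracontractivity).** For every $n\ge1$ there is a constant $\kappa_n>0$, depending only on $n$, such that for every Schwartz state $\rho$ with (pointwise) nonnegative Wigner function and every $t>0$, the state $\rho_t=\Lambda_t(\rho)$ satisfies $$\|\rho_t\|_\infty\le\|\rho_t\|_2\le\kappa_n\,t^{-n/2},$$ $$\operatorname{Tr}\rho_t^2=\|\rho_t\|_2^2\le\kappa_n^2\,t^{-n},\qquad S(\rho_t)\ge\frac n2\ln\bigl(\kappa_n^{-2/n}\,t\bigr).$$ -/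

import Mathlib

namespace QuantumDiffusion

open MeasureTheory Filter Topology ContinuousLinearMap
open scoped ENNReal InnerProductSpace SchwartzMap

noncomputable section

/-! ### Traces, trace norm, Hilbert-Schmidt norm, states, entropy on a Hilbert space -/

section Trace

variable {E : Type*} [NormedAddCommGroup E] [InnerProductSpace ℂ E] [CompleteSpace E]

variable (E) in
/-- The index set of a chosen orthonormal (Hilbert) basis of `E`. -/
def basisIndex : Set E := (exists_hilbertBasis ℂ E).choose

variable (E) in
/-- A chosen orthonormal (Hilbert) basis of `E`. The traces below do not depend on the choice. -/
def onb : HilbertBasis (basisIndex E) ℂ E := (exists_hilbertBasis ℂ E).choose_spec.choose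

/-- The trace of a *positive* operator, with values in `[0, ∞]`. -/
def posTrace (A : E →L[ℂ] E) : ℝ≥0∞ :=
  ∑' i, ENNReal.ofReal (⟪onb E i, A (onb E i)⟫_ℂ).re

/-- The trace of a trace class operator. -/
def trace (A : E →L[ℂ] E) : ℂ := ∑' i, ⟪onb E i, A (onb E i)⟫_ℂ

/-- The trace norm `‖A‖₁ = Tr |A|`, where `|A| = (A* A)^{1/2}`. -/
def traceNorm (A : E →L[ℂ] E) : ℝ≥0∞ := posTrace (CFC.abs A)

/-- The Hilbert-Schmidt norm `‖A‖₂ = (Tr |A|²)^{1/2}`. -/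
def hsNorm (A : E →L[ℂ] E) : ℝ≥0∞ := posTrace (CFC.abs A ^ 2) ^ (1 / 2 : ℝ)

/-- `A` is trace class: `Tr |A| < ∞`. -/
def IsTraceClass (A : E →L[ℂ] E) : Prop := traceNorm A < ∞

/-- Density matrices: positive semidefinite operators of trace one. -/
structure IsState (ρ : E →L[ℂ] E) : Prop where
  isPositive : ρ.IsPositive
  trace_eq_one : trace ρ = 1

/-- The von Neumann entropy `S(ρ) = -Tr (ρ ln ρ) ∈ [0, ∞]` of a state; the operator `-ρ ln ρ ≥ 0`
is obtained by applying `x ↦ -x ln x` (with value `0` at `0`) to `ρ` in the continuous functional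
calculus. -/
def entropy (ρ : E →L[ℂ] E) : ℝ≥0∞ := posTrace (cfc Real.negMulLog ρ)

open scoped ComplexOrder in
/-- A `k × k` matrix of operators on `E` is positive as an operator on the direct sum of `k` copies
of `E`. -/
def IsBlockPositive {k : ℕ} (A : Fin k → Fin k → (E →L[ℂ] E)) : Prop :=
  ∀ x : Fin k → E, 0 ≤ ∑ i, ∑ j, ⟪x i, A i j (x j)⟫_ℂ

/-- `(Λ t)_{t ≥ 0}` is a quantum dynamical semigroup: a strongly continuous one-parameter semigroup
of linear, completely positive, trace preserving maps on the trace class operators. (Values of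
`Λ t` at operators which are not trace class, and at `t < 0`, play no role.) -/
structure IsQuantumDynamicalSemigroup (Λ : ℝ → (E →L[ℂ] E) → (E →L[ℂ] E)) : Prop where
  isTraceClass : ∀ t, 0 ≤ t → ∀ A, IsTraceClass A → IsTraceClass (Λ t A)
  map_add : ∀ t, 0 ≤ t → ∀ A B, IsTraceClass A → IsTraceClass B →
    Λ t (A + B) = Λ t A + Λ t B
  map_smul : ∀ t, 0 ≤ t → ∀ (c : ℂ) A, IsTraceClass A → Λ t (c • A) = c • Λ t A
  completely_positive : ∀ t, 0 ≤ t → ∀ (k : ℕ) (A : Fin k → Fin k → (E →L[ℂ] E)),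
    (∀ i j, IsTraceClass (A i j)) → IsBlockPositive A → IsBlockPositive fun i j => Λ t (A i j)
  trace_preserving : ∀ t, 0 ≤ t → ∀ A, IsTraceClass A → trace (Λ t A) = trace A
  map_zero_time : ∀ A, IsTraceClass A → Λ 0 A = A
  map_add_time : ∀ s t, 0 ≤ s → 0 ≤ t → ∀ A, IsTraceClass A → Λ (s + t) A = Λ s (Λ t A)
  strongly_continuous : ∀ A, IsTraceClass A →
    Tendsto (fun t => traceNorm (Λ t A - A)) (𝓝[>] 0) (𝓝 0)

end Trace

/-! ### The canonical commutation relations with `n` modes -/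

/-- Configuration space `ℝⁿ`. -/
abbrev Config (n : ℕ) : Type := EuclideanSpace ℝ (Fin n)

/-- The Hilbert space `L²(ℝⁿ)`. -/
abbrev StateSpace (n : ℕ) : Type := Lp ℂ 2 (volume : Measure (Config n))

/-- Phase space `ℝ²ⁿ`: a point `z` has positions `q_j = z (inl j)` and momenta `p_j = z (inr j)`. -/
abbrev PhaseSpace (n : ℕ) : Type := EuclideanSpace ℝ (Fin n ⊕ Fin n)

variable {n : ℕ}

/-- The position part `q ∈ ℝⁿ` of a point of phase space. -/
def pos (z : PhaseSpace n) : Config n := WithLp.toLp 2 fun j => z (Sum.inl j)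

/-- The momentum part `p ∈ ℝⁿ` of a point of phase space. -/
def mom (z : PhaseSpace n) : Config n := WithLp.toLp 2 fun j => z (Sum.inr j)

/-- The phase `e^{-i (p·x + p·q/2)}`. -/
def weylPhase (z : PhaseSpace n) (x : Config n) : ℂ :=
  Complex.exp (-Complex.I * ((⟪mom z, x⟫_ℝ + ⟪mom z, pos z⟫_ℝ / 2 : ℝ) : ℂ))

lemma norm_weylPhase (z : PhaseSpace n) (x : Config n) : ‖weylPhase z x‖ = 1 := by
  rw [weylPhase, Complex.norm_exp]
  simp

lemma continuous_weylPhase (z : PhaseSpace n) : Continuous (weylPhase z) := by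
  unfold weylPhase
  fun_prop

lemma memLp_weyl (z : PhaseSpace n) (ψ : StateSpace n) :
    MemLp (fun x => weylPhase z x * ψ x) 2 (volume : Measure (Config n)) := by
  refine (Lp.memLp ψ).of_le
    ((continuous_weylPhase z).aestronglyMeasurable.mul (Lp.aestronglyMeasurable ψ)) ?_
  exact Eventually.of_forall fun x => by simp [norm_weylPhase]

/-- Multiplication of a wave function by the phase `e^{-i (p·x + p·q/2)}`. -/
def phaseMul (z : PhaseSpace n) : StateSpace n →ₗᵢ[ℂ] StateSpace n where
  toFun ψ := (memLp_weyl z ψ).toLp _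
  map_add' φ ψ := by
    rw [← MemLp.toLp_add]
    apply MemLp.toLp_congr
    filter_upwards [Lp.coeFn_add φ ψ] with x hx
    rw [hx, Pi.add_apply, Pi.add_apply, mul_add]
  map_smul' c ψ := by
    rw [RingHom.id_apply, ← MemLp.toLp_const_smul]
    apply MemLp.toLp_congr
    filter_upwards [Lp.coeFn_smul c ψ] with x hx
    simp [hx, mul_left_comm]
  norm_map' ψ := by
    change ‖(memLp_weyl z ψ).toLp _‖ = ‖ψ‖
    rw [Lp.norm_toLp, Lp.norm_def]
    congr 1
    exact eLpNorm_congr_norm_ae (Eventually.of_forall fun x => by simp [norm_weylPhase])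

/-- The Weyl operator `V(z) = exp (i ∑ⱼ (q_j P_j - p_j Q_j))` on `L²(ℝⁿ)`, explicitly
`(V(z) ψ)(x) = e^{-i (p·x + p·q/2)} ψ(x + q)`. -/
def weyl (z : PhaseSpace n) : StateSpace n →L[ℂ] StateSpace n :=
  ((phaseMul z).comp (Lp.compMeasurePreservingₗᵢ ℂ (fun x => x + pos z)
    (measurePreserving_add_right volume (pos z)))).toContinuousLinearMap

/-- The direction `ζ_j` in phase space such that `V(t ζ_j) = exp (i t R_j)`: it is `-p^{(j)}` for
`R_j = Q_j` and `q^{(j)}` for `R_j = P_j`, where `q^{(j)}`, `p^{(j)}` are the unit vectors of the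
`j`-th position and momentum coordinate. -/
def direction : Fin n ⊕ Fin n → PhaseSpace n
  | Sum.inl j => -EuclideanSpace.single (Sum.inr j) 1
  | Sum.inr j => EuclideanSpace.single (Sum.inl j) 1

/-- `φ` is in the domain of the canonical observable `R_j` (`Q_j` for `inl j`, `P_j` for `inr j`),
the self-adjoint generator of the unitary group `t ↦ V(t ζ_j)`. -/
def InDomR (j : Fin n ⊕ Fin n) (φ : StateSpace n) : Prop :=
  DifferentiableAt ℝ (fun t : ℝ => weyl (t • direction j) φ) 0

/-- `R_j φ = -i d/dt V(t ζ_j) φ` at `t = 0`, for `φ` in the domain of `R_j`. -/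
def opR (j : Fin n ⊕ Fin n) (φ : StateSpace n) : StateSpace n :=
  -Complex.I • deriv (fun t : ℝ => weyl (t • direction j) φ) 0

/-- `φ` is in the domain of `R_j²` for every `j`. -/
def InDomRSq (φ : StateSpace n) : Prop :=
  ∀ j, InDomR j φ ∧ InDomR j (opR j φ)

/-- The operator `|φ⟩⟨ψ|`. -/
abbrev ketBra (φ ψ : StateSpace n) : StateSpace n →L[ℂ] StateSpace n :=
  InnerProductSpace.rankOne ℂ φ ψ

/-- `𝓛(|φ⟩⟨ψ|) = -1/4 ∑ⱼ [R_j, [R_j, |φ⟩⟨ψ|]]`, with the double commutator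
`R_j² X - 2 R_j X R_j + X R_j²` written out for `X = |φ⟩⟨ψ|`. -/
def generator (φ ψ : StateSpace n) : StateSpace n →L[ℂ] StateSpace n :=
  -(1 / 4 : ℂ) • ∑ j, (ketBra (opR j (opR j φ)) ψ - (2 : ℂ) • ketBra (opR j φ) (opR j ψ)
    + ketBra φ (opR j (opR j ψ)))

/-- `(Λ t)_{t ≥ 0}` is the quantum diffusion semigroup: the quantum dynamical semigroup whose
generator extends `𝓛 = -1/4 ∑ⱼ [R_j, [R_j, ·]]` from the span of the operators `|φ⟩⟨ψ|` with `φ`, `ψ`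
in the domains of all `R_j²`. The derivative at `t = 0` is taken in trace norm; by linearity it is
enough to prescribe it on the spanning set. -/
structure IsQuantumDiffusionSemigroup
    (Λ : ℝ → (StateSpace n →L[ℂ] StateSpace n) → (StateSpace n →L[ℂ] StateSpace n)) : Prop
    extends IsQuantumDynamicalSemigroup Λ where
  generator_eq : ∀ φ ψ : StateSpace n, InDomRSq φ → InDomRSq ψ →
    Tendsto (fun t : ℝ => traceNorm
      ((t : ℂ)⁻¹ • (Λ t (ketBra φ ψ) - ketBra φ ψ) - generator φ ψ)) (𝓝[>] 0) (𝓝 0)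

/-- The quantum characteristic function `χ_ρ(z) = Tr (ρ V(z))`. -/
def charFun (ρ : StateSpace n →L[ℂ] StateSpace n) (z : PhaseSpace n) : ℂ :=
  trace (ρ ∘L weyl z)

/-- The Wigner function `u ↦ (2π)^{-n} ∫ e^{-i (u, z)} χ_ρ(z) dz`. -/
def wigner (ρ : StateSpace n →L[ℂ] StateSpace n) (u : PhaseSpace n) : ℂ :=
  ((2 * Real.pi : ℝ) : ℂ) ^ (-(n : ℤ)) *
    ∫ z : PhaseSpace n, Complex.exp (-Complex.I * (⟪u, z⟫_ℝ : ℂ)) * charFun ρ z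

/-- A Schwartz state: a state whose characteristic function is a Schwartz function on `ℝ²ⁿ`. -/
structure IsSchwartzState (ρ : StateSpace n →L[ℂ] StateSpace n) : Prop extends IsState ρ where
  charFun_schwartz : ∃ f : 𝓢(PhaseSpace n, ℂ), ∀ z, f z = charFun ρ z

open scoped ComplexOrder in
/-- The Wigner function of `ρ` takes nonnegative real values. -/
def HasPositiveWigner (ρ : StateSpace n →L[ℂ] StateSpace n) : Prop :=
  ∀ u, 0 ≤ wigner ρ u

end

end QuantumDiffusion

namespace QuantumDiffusion

open MeasureTheory Filter Topology ContinuousLinearMap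
open scoped ENNReal InnerProductSpace SchwartzMap

noncomputable section

/-! ### Finite rank operators -/

section FiniteRank

variable {E : Type*} [NormedAddCommGroup E] [InnerProductSpace ℂ E]

/-! Everything follows from the operator norm bound `‖Λ t ρ‖ ≤ (2 / t) ^ n`
(`IsQuantumDiffusionSemigroup.norm_map_le`), proved by turning the quantum evolution into a
classical heat flow on phase space.

Fix vectors `φ`, `ψ` and put `u(t, w) = ⟨ψ, Λ_t(|V(w)φ⟩⟨V(w)φ|) ψ⟩`. Moving `w` along `direction j`
conjugates the projector by `exp(i s R_j)`, so a second derivative in that direction produces minus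
the double commutator with `R_j`. The prescribed generator then says exactly that `∂ₜu = ¼Δu`
(`IsQuantumDiffusionSemigroup.isHeatSolutionAt`). The solution `u` is nonnegative and bounded, and
`u(0, w) = |⟨ψ, V(w)φ⟩|²` has integral `(2π)ⁿ‖φ‖²‖ψ‖²` by Plancherel
(`IsTestVector.integral_norm_sq_inner_weyl`). In dimension `2n` the kernel of `exp(tΔ/4)` is at most
`(πt)⁻ⁿ`. A maximum principle (`le_of_isHeatSolutionAt`) compares `u` with the explicit heat flow,
and `le_heatKernel_mul_integral` yields `u(t, 0) ≤ (πt)⁻ⁿ(2π)ⁿ‖φ‖²‖ψ‖² = (2/t)ⁿ‖φ‖²‖ψ‖²`.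

This is done for smooth compactly supported `φ`, `ψ`, which lie in all the required domains, and
extends to all vectors by density. Writing `ρ = S²` and summing over the rank one pieces `|S eᵢ⟩⟨S
eᵢ|`, whose traces add up to one, gives the norm bound for `Λ_t ρ`.

Finally, for a state `σ`, `Tr σ² ≤ ‖σ‖`, `‖σ‖ ≤ ‖σ‖₂`, and `S(σ) ≥ -ln m` whenever `‖σ‖ ≤ m`. Hence
`κ = 2^{n/2}` works. -/

lemma IsPositive.re_nonneg {A : E →L[ℂ] E} (hA : A.IsPositive) (x : E) : 0 ≤ (⟪x, A x⟫_ℂ).re :=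
  hA.re_inner_nonneg_right x

lemma re_inner_rankOne_self (x y : E) :
    (⟪x, InnerProductSpace.rankOne ℂ y y x⟫_ℂ).re = ‖⟪x, y⟫_ℂ‖ ^ 2 := by
  rw [InnerProductSpace.rankOne_apply, inner_smul_right, ← inner_conj_symm y x, mul_comm,
    Complex.mul_conj, Complex.ofReal_re, Complex.normSq_eq_norm_sq]

lemma IsPositive.inner_eq_re {A : E →L[ℂ] E} (hA : A.IsPositive) (x : E) :
    ⟪x, A x⟫_ℂ = ((⟪x, A x⟫_ℂ).re : ℂ) := by
  have h := ((isPositive_iff_complex A).1 hA x).1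
  rw [hA.inner_left_eq_inner_right] at h
  exact h.symm

/-- `A` vanishes on the orthogonal complement of a finite dimensional subspace. -/
def IsFiniteRank (A : E →L[ℂ] E) : Prop :=
  ∃ K : Submodule ℂ E, FiniteDimensional ℂ K ∧ ∀ x ∈ Kᗮ, A x = 0

lemma isFiniteRank_rankOne (a b : E) : IsFiniteRank (InnerProductSpace.rankOne ℂ a b) := by
  refine ⟨ℂ ∙ b, inferInstance, fun x hx => ?_⟩
  rw [InnerProductSpace.rankOne_apply, (Submodule.mem_orthogonal_singleton_iff_inner_right).1 hx,
    zero_smul]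

lemma IsFiniteRank.add {A B : E →L[ℂ] E} (hA : IsFiniteRank A) (hB : IsFiniteRank B) :
    IsFiniteRank (A + B) := by
  obtain ⟨K, hK, hA⟩ := hA
  obtain ⟨L, hL, hB⟩ := hB
  refine ⟨K ⊔ L, inferInstance, fun x hx => ?_⟩
  rw [add_apply, hA x (Submodule.orthogonal_le le_sup_left hx),
    hB x (Submodule.orthogonal_le le_sup_right hx), add_zero]

lemma IsFiniteRank.smul {A : E →L[ℂ] E} (hA : IsFiniteRank A) (c : ℂ) : IsFiniteRank (c • A) := by
  obtain ⟨K, hK, hA⟩ := hA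
  exact ⟨K, hK, fun x hx => by rw [smul_apply, hA x hx, smul_zero]⟩

lemma IsFiniteRank.sub {A B : E →L[ℂ] E} (hA : IsFiniteRank A) (hB : IsFiniteRank B) :
    IsFiniteRank (A - B) := by
  have := hA.add (hB.smul (-1))
  rwa [neg_one_smul, ← sub_eq_add_neg] at this

lemma isFiniteRank_zero : IsFiniteRank (0 : E →L[ℂ] E) :=
  ⟨⊥, inferInstance, fun _ _ => rfl⟩

lemma isFiniteRank_sum {ι : Type*} (s : Finset ι) (A : ι → E →L[ℂ] E)
    (h : ∀ i ∈ s, IsFiniteRank (A i)) : IsFiniteRank (∑ i ∈ s, A i) := by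
  classical
  induction s using Finset.induction_on with
  | empty => simpa using isFiniteRank_zero
  | insert a s ha ih =>
    rw [Finset.sum_insert ha]
    exact (h a (by simp)).add (ih fun i hi => h i (by simp [hi]))

end FiniteRank

/-! ### Traces of positive operators and the trace norm -/

section TraceLemmas

variable {E : Type*} [NormedAddCommGroup E] [InnerProductSpace ℂ E] [CompleteSpace E]

lemma posTrace_add {A B : E →L[ℂ] E} (hA : A.IsPositive) (hB : B.IsPositive) :
    posTrace (A + B) = posTrace A + posTrace B := by
  unfold posTrace
  rw [← ENNReal.tsum_add]
  refine tsum_congr fun i => ?_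
  rw [← ENNReal.ofReal_add (IsPositive.re_nonneg hA _) (IsPositive.re_nonneg hB _)]
  simp

lemma posTrace_smul {A : E →L[ℂ] E} {c : ℝ} (hc : 0 ≤ c) :
    posTrace ((c : ℂ) • A) = ENNReal.ofReal c * posTrace A := by
  unfold posTrace
  rw [← ENNReal.tsum_mul_left]
  refine tsum_congr fun i => ?_
  rw [← ENNReal.ofReal_mul hc]
  simp

lemma posTrace_mono {A B : E →L[ℂ] E} (h : A ≤ B) : posTrace A ≤ posTrace B := by
  refine ENNReal.tsum_le_tsum fun i => ENNReal.ofReal_le_ofReal ?_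
  have := (ContinuousLinearMap.le_def A B).1 h |>.re_inner_nonneg_right (onb E i)
  simpa [inner_sub_right] using this

lemma traceNorm_of_isPositive {A : E →L[ℂ] E} (hA : A.IsPositive) : traceNorm A = posTrace A := by
  rw [traceNorm, CFC.abs_of_nonneg A ((nonneg_iff_isPositive A).2 hA)]

lemma isTraceClass_iff_of_isPositive {A : E →L[ℂ] E} (hA : A.IsPositive) :
    IsTraceClass A ↔ posTrace A < ∞ := by
  rw [IsTraceClass, traceNorm_of_isPositive hA]

lemma hasSum_norm_inner_onb_sq (x : E) :
    HasSum (fun i => ‖⟪onb E i, x⟫_ℂ‖ ^ 2) (‖x‖ ^ 2) := by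
  have h := (onb E).hasSum_inner_mul_inner x x
  have h2 := Complex.hasSum_re h
  convert h2 using 1
  · ext i
    rw [← inner_conj_symm x, mul_comm,
      Complex.mul_conj, Complex.ofReal_re, Complex.normSq_eq_norm_sq]
  · exact (inner_self_eq_norm_sq (𝕜 := ℂ) x).symm

lemma tsum_ofReal_norm_inner_onb_sq (x : E) :
    ∑' i, ENNReal.ofReal (‖⟪onb E i, x⟫_ℂ‖ ^ 2) = ENNReal.ofReal (‖x‖ ^ 2) := by
  rw [← ENNReal.ofReal_tsum_of_nonneg (fun i => by positivity)
    (hasSum_norm_inner_onb_sq x).summable, (hasSum_norm_inner_onb_sq x).tsum_eq]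

lemma posTrace_rankOne_self (x : E) :
    posTrace (InnerProductSpace.rankOne ℂ x x) = ENNReal.ofReal (‖x‖ ^ 2) := by
  unfold posTrace
  simp_rw [re_inner_rankOne_self]
  exact tsum_ofReal_norm_inner_onb_sq x

lemma exists_isSelfAdjoint_mul_self_eq {A : E →L[ℂ] E} (hA : A.IsPositive) :
    ∃ S : E →L[ℂ] E, IsSelfAdjoint S ∧ S * S = A := by
  have h0 := (nonneg_iff_isPositive A).2 hA
  exact ⟨CFC.sqrt A, (CFC.sqrt_nonneg A).isSelfAdjoint, CFC.sqrt_mul_sqrt_self A h0⟩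

lemma re_inner_mul_self {S : E →L[ℂ] E} (hS : IsSelfAdjoint S) (x : E) :
    (⟪x, (S * S) x⟫_ℂ).re = ‖S x‖ ^ 2 := by
  have : ⟪x, (S * S) x⟫_ℂ = ⟪S x, S x⟫_ℂ := by
    rw [mul_apply_eq_comp, ← ContinuousLinearMap.adjoint_inner_left,
      hS.adjoint_eq]
  rw [this]
  exact inner_self_eq_norm_sq (𝕜 := ℂ) (S x)

/-- With `A = S²`, expand `‖S x‖²` in the basis, move `S` onto the basis vectors and apply
Cauchy–Schwarz to each term. -/
lemma re_inner_le_posTrace {A : E →L[ℂ] E} (hA : A.IsPositive) (x : E) :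
    ENNReal.ofReal (⟪x, A x⟫_ℂ).re ≤ posTrace A * ENNReal.ofReal (‖x‖ ^ 2) := by
  obtain ⟨S, hS, rfl⟩ := exists_isSelfAdjoint_mul_self_eq hA
  unfold posTrace
  simp_rw [re_inner_mul_self hS]
  rw [← tsum_ofReal_norm_inner_onb_sq, ← ENNReal.tsum_mul_right]
  refine ENNReal.tsum_le_tsum fun i => ?_
  rw [← ENNReal.ofReal_mul (by positivity)]
  refine ENNReal.ofReal_le_ofReal ?_
  rw [← ContinuousLinearMap.adjoint_inner_left, hS.adjoint_eq, ← mul_pow]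
  exact pow_le_pow_left₀ (norm_nonneg _) (norm_inner_le_norm _ _) 2

lemma re_inner_le_toReal_posTrace {A : E →L[ℂ] E} (hA : A.IsPositive) (hf : posTrace A < ∞) (x : E) :
    (⟪x, A x⟫_ℂ).re ≤ (posTrace A).toReal * ‖x‖ ^ 2 := by
  have h := re_inner_le_posTrace hA x
  rwa [← ENNReal.ofReal_toReal hf.ne, ← ENNReal.ofReal_mul ENNReal.toReal_nonneg,
    ENNReal.ofReal_le_ofReal_iff (by positivity)] at h

lemma trace_eq_of_isPositive {A : E →L[ℂ] E} (hA : A.IsPositive) :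
    trace A = ((posTrace A).toReal : ℂ) := by
  unfold trace posTrace
  rw [ENNReal.tsum_toReal_eq (fun i => ENNReal.ofReal_ne_top), Complex.ofReal_tsum]
  refine tsum_congr fun i => ?_
  rw [ENNReal.toReal_ofReal (IsPositive.re_nonneg hA _)]
  exact IsPositive.inner_eq_re hA _

lemma IsState.posTrace_eq_one {ρ : E →L[ℂ] E} (h : IsState ρ) : posTrace ρ = 1 := by
  have hs : Summable fun i => ⟪onb E i, ρ (onb E i)⟫_ℂ := by
    -- An unsummable `tsum` is `0` by convention, so trace one forces summability of the diagonal.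
    by_contra hn
    have := h.trace_eq_one
    rw [trace, tsum_eq_zero_of_not_summable hn] at this
    exact zero_ne_one this
  have h2 := (Complex.hasSum_re hs.hasSum)
  have h3 := h.trace_eq_one
  rw [trace] at h3
  rw [h3, Complex.one_re] at h2
  unfold posTrace
  rw [← ENNReal.ofReal_tsum_of_nonneg (fun i => IsPositive.re_nonneg h.isPositive _) h2.summable,
    h2.tsum_eq, ENNReal.ofReal_one]

lemma IsState.isTraceClass {ρ : E →L[ℂ] E} (h : IsState ρ) : IsTraceClass ρ := by
  rw [isTraceClass_iff_of_isPositive h.isPositive, h.posTrace_eq_one]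
  exact ENNReal.one_lt_top

/-- This Jordan splitting lets trace norm estimates for self-adjoint operators be deduced from
positive operators alone, where the trace is additive. -/
lemma traceNorm_eq_posPart_add_negPart {Z : E →L[ℂ] E} (hZ : IsSelfAdjoint Z) :
    traceNorm Z = posTrace Z⁺ + posTrace Z⁻ := by
  rw [traceNorm, ← CFC.posPart_add_negPart Z hZ]
  exact posTrace_add ((nonneg_iff_isPositive _).1 (CFC.posPart_nonneg Z))
    ((nonneg_iff_isPositive _).1 (CFC.negPart_nonneg Z))

lemma posTrace_starProjection_lt_top (K : Submodule ℂ E) [FiniteDimensional ℂ K] :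
    posTrace K.starProjection < ∞ := by
  rw [(stdOrthonormalBasis ℂ K).starProjection_eq_sum_rankOne]
  have : ∀ s : Finset (Fin (Module.finrank ℂ K)), posTrace (∑ i ∈ s,
      InnerProductSpace.rankOne ℂ (stdOrthonormalBasis ℂ K i : E) (stdOrthonormalBasis ℂ K i : E))
        < ∞ := by
    classical
    intro s
    induction s using Finset.induction_on with
    | empty => simp [posTrace]
    | insert a s ha ih =>
      rw [Finset.sum_insert ha, posTrace_add (InnerProductSpace.isPositive_rankOne_self _)
        (isPositive_sum _ fun i _ => InnerProductSpace.isPositive_rankOne_self _),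
        posTrace_rankOne_self]
      exact ENNReal.add_lt_top.2 ⟨ENNReal.ofReal_lt_top, ih⟩
  exact this _

lemma norm_abs_apply (A : E →L[ℂ] E) (x : E) : ‖CFC.abs A x‖ = ‖A x‖ := by
  have h1 := re_inner_mul_self (S := CFC.abs A) (CFC.abs_nonneg A).isSelfAdjoint x
  have h2 : ⟪x, (star A * A) x⟫_ℂ = ⟪A x, A x⟫_ℂ := by
    rw [mul_apply_eq_comp, ContinuousLinearMap.star_eq_adjoint,
      ContinuousLinearMap.adjoint_inner_right]
  rw [CFC.abs_mul_abs, h2] at h1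
  have h3 : (⟪A x, A x⟫_ℂ).re = ‖A x‖ ^ 2 := inner_self_eq_norm_sq (𝕜 := ℂ) (A x)
  rw [h3] at h1
  exact ((pow_left_inj₀ (norm_nonneg _) (norm_nonneg _) two_ne_zero).1 h1).symm

/-- Since `‖|A| x‖ = ‖A x‖`, the operator `|A|` also vanishes on `Kᗮ`. Being self-adjoint, it is
dominated as a quadratic form by `‖A‖` times the projection onto `K`, whose trace is finite. -/
lemma IsFiniteRank.isTraceClass {A : E →L[ℂ] E} (hA : IsFiniteRank A) : IsTraceClass A := by
  obtain ⟨K, hK, hA⟩ := hA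
  set T := CFC.abs A with hT
  have hTsa : IsSelfAdjoint T := (CFC.abs_nonneg A).isSelfAdjoint
  have hTP : ∀ x, T x = T (K.starProjection x) := fun x => by
    have h1 : T (x - K.starProjection x) = 0 := by
      rw [← norm_eq_zero, hT, norm_abs_apply, hA _ (K.sub_starProjection_mem_orthogonal x),
        norm_zero]
    rwa [map_sub, sub_eq_zero] at h1
  have key : ∀ x, (⟪x, T x⟫_ℂ).re ≤ ‖T‖ * (⟪x, K.starProjection x⟫_ℂ).re := fun x => by
    have h1 : ⟪x, T x⟫_ℂ = ⟪K.starProjection x, T (K.starProjection x)⟫_ℂ := by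
      rw [hTP x, ← ContinuousLinearMap.adjoint_inner_left, hTsa.adjoint_eq, hTP x]
      conv_rhs => rw [← ContinuousLinearMap.adjoint_inner_left, hTsa.adjoint_eq]
    have h2 : (⟪x, K.starProjection x⟫_ℂ).re = ‖K.starProjection x‖ ^ 2 := by
      have := re_inner_mul_self (S := K.starProjection) (isSelfAdjoint_starProjection K) x
      rwa [(K.isIdempotentElem_starProjection).eq] at this
    rw [h1, h2]
    calc _ ≤ ‖⟪K.starProjection x, T (K.starProjection x)⟫_ℂ‖ := Complex.re_le_norm _
      _ ≤ ‖K.starProjection x‖ * (‖T‖ * ‖K.starProjection x‖) :=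
        (norm_inner_le_norm _ _).trans (by gcongr; exact T.le_opNorm _)
      _ = _ := by ring
  refine lt_of_le_of_lt (b := ENNReal.ofReal ‖T‖ * posTrace K.starProjection) ?_
    (ENNReal.mul_lt_top ENNReal.ofReal_lt_top (posTrace_starProjection_lt_top K))
  unfold traceNorm posTrace
  rw [← ENNReal.tsum_mul_left]
  refine ENNReal.tsum_le_tsum fun i => ?_
  rw [← ENNReal.ofReal_mul (norm_nonneg _)]
  exact ENNReal.ofReal_le_ofReal (key _)

end TraceLemmas

/-! ### Expectation values along a quantum dynamical semigroup -/

section Semigroup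

variable {E : Type*} [NormedAddCommGroup E] [InnerProductSpace ℂ E] [CompleteSpace E]
  {Λ : ℝ → (E →L[ℂ] E) → (E →L[ℂ] E)} {s t : ℝ}

namespace IsQuantumDynamicalSemigroup

lemma isPositive (hΛ : IsQuantumDynamicalSemigroup Λ) (ht : 0 ≤ t) {A : E →L[ℂ] E}
    (hA : A.IsPositive) (hf : IsTraceClass A) : (Λ t A).IsPositive := by
  -- Only the `1 × 1` blocks of complete positivity matter here.
  have h := hΛ.completely_positive t ht 1 (fun _ _ => A) (fun _ _ => hf)
    (fun x => by simpa using hA.inner_nonneg_right (x 0))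
  rw [isPositive_iff_complex]
  intro x
  have hx := h fun _ => x
  simp only [Finset.univ_unique, Finset.sum_singleton] at hx
  rw [Complex.nonneg_iff] at hx
  have hc : ⟪Λ t A x, x⟫_ℂ = ⟪x, Λ t A x⟫_ℂ := by
    rw [← inner_conj_symm, Complex.conj_eq_iff_im, hx.2]
  rw [hc]
  exact ⟨Complex.ext rfl hx.2, hx.1⟩

lemma posTrace_map (hΛ : IsQuantumDynamicalSemigroup Λ) (ht : 0 ≤ t) {A : E →L[ℂ] E}
    (hA : A.IsPositive) (hf : IsTraceClass A) : posTrace (Λ t A) = posTrace A := by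
  have h := hΛ.trace_preserving t ht A hf
  have hP := hΛ.isPositive ht hA hf
  rw [trace_eq_of_isPositive hA, trace_eq_of_isPositive hP] at h
  have h1 := (isTraceClass_iff_of_isPositive hA).1 hf
  have h2 := (isTraceClass_iff_of_isPositive hP).1 (hΛ.isTraceClass t ht A hf)
  exact (ENNReal.toReal_eq_toReal_iff' h2.ne h1.ne).1 (Complex.ofReal_injective h)

end IsQuantumDynamicalSemigroup

lemma IsTraceClass.posPart {Z : E →L[ℂ] E} (hf : IsTraceClass Z) (hZ : IsSelfAdjoint Z) :
    IsTraceClass Z⁺ := by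
  rw [isTraceClass_iff_of_isPositive ((nonneg_iff_isPositive _).1 (CFC.posPart_nonneg Z))]
  rw [IsTraceClass, traceNorm_eq_posPart_add_negPart hZ] at hf
  exact (ENNReal.add_lt_top.1 hf).1

lemma IsTraceClass.negPart {Z : E →L[ℂ] E} (hf : IsTraceClass Z) (hZ : IsSelfAdjoint Z) :
    IsTraceClass Z⁻ := by
  rw [isTraceClass_iff_of_isPositive ((nonneg_iff_isPositive _).1 (CFC.negPart_nonneg Z))]
  rw [IsTraceClass, traceNorm_eq_posPart_add_negPart hZ] at hf
  exact (ENNReal.add_lt_top.1 hf).2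

lemma IsTraceClass.smul {A : E →L[ℂ] E} (hA : IsTraceClass A) (c : ℂ) : IsTraceClass (c • A) := by
  unfold IsTraceClass traceNorm
  rw [CFC.abs_smul, ← Complex.coe_smul, posTrace_smul (norm_nonneg c)]
  exact ENNReal.mul_lt_top ENNReal.ofReal_lt_top hA

namespace IsQuantumDynamicalSemigroup

lemma map_sub (hΛ : IsQuantumDynamicalSemigroup Λ) (ht : 0 ≤ t) {A B : E →L[ℂ] E}
    (hA : IsTraceClass A) (hB : IsTraceClass B) : Λ t (A - B) = Λ t A - Λ t B := by
  have h := hΛ.map_add t ht A ((-1 : ℂ) • B) hA (hB.smul _)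
  rwa [hΛ.map_smul t ht _ _ hB, neg_one_smul, neg_one_smul, ← sub_eq_add_neg,
    ← sub_eq_add_neg] at h

lemma map_eq_posPart_sub_negPart (hΛ : IsQuantumDynamicalSemigroup Λ) (ht : 0 ≤ t)
    {Z : E →L[ℂ] E} (hZ : IsSelfAdjoint Z) (hf : IsTraceClass Z) :
    Λ t Z = Λ t Z⁺ - Λ t Z⁻ := by
  rw [← hΛ.map_sub ht (hf.posPart hZ) (hf.negPart hZ), CFC.posPart_sub_negPart Z hZ]

lemma isSelfAdjoint (hΛ : IsQuantumDynamicalSemigroup Λ) (ht : 0 ≤ t)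
    {Z : E →L[ℂ] E} (hZ : IsSelfAdjoint Z) (hf : IsTraceClass Z) : IsSelfAdjoint (Λ t Z) := by
  rw [hΛ.map_eq_posPart_sub_negPart ht hZ hf]
  exact (hΛ.isPositive ht ((nonneg_iff_isPositive _).1 (CFC.posPart_nonneg Z))
    (hf.posPart hZ)).isSelfAdjoint.sub (hΛ.isPositive ht
    ((nonneg_iff_isPositive _).1 (CFC.negPart_nonneg Z)) (hf.negPart hZ)).isSelfAdjoint

lemma re_inner_map_le (hΛ : IsQuantumDynamicalSemigroup Λ) (ht : 0 ≤ t) {A : E →L[ℂ] E}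
    (hA : A.IsPositive) (hf : IsTraceClass A) (ψ : E) :
    (⟪ψ, Λ t A ψ⟫_ℂ).re ≤ (posTrace A).toReal * ‖ψ‖ ^ 2 := by
  rw [← hΛ.posTrace_map ht hA hf]
  have hP := hΛ.isPositive ht hA hf
  exact re_inner_le_toReal_posTrace hP
    ((isTraceClass_iff_of_isPositive hP).1 (hΛ.isTraceClass t ht A hf)) ψ

/-- A weak form of trace norm contractivity, uniform in `t`: the images of `Z⁺` and `Z⁻` are
positive with unchanged traces, and an expectation of a positive operator is at most its trace times
`‖ψ‖²`. -/
lemma abs_re_inner_map_le (hΛ : IsQuantumDynamicalSemigroup Λ) (ht : 0 ≤ t) {Z : E →L[ℂ] E}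
    (hZ : IsSelfAdjoint Z) (hf : IsTraceClass Z) (ψ : E) :
    |(⟪ψ, Λ t Z ψ⟫_ℂ).re| ≤ (traceNorm Z).toReal * ‖ψ‖ ^ 2 := by
  have hp := (nonneg_iff_isPositive _).1 (CFC.posPart_nonneg Z)
  have hn := (nonneg_iff_isPositive _).1 (CFC.negPart_nonneg Z)
  have h1 := hΛ.re_inner_map_le ht hp (hf.posPart hZ) ψ
  have h2 := hΛ.re_inner_map_le ht hn (hf.negPart hZ) ψ
  have h3 := IsPositive.re_nonneg (hΛ.isPositive ht hp (hf.posPart hZ)) ψ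
  have h4 := IsPositive.re_nonneg (hΛ.isPositive ht hn (hf.negPart hZ)) ψ
  have h5 : (traceNorm Z).toReal = (posTrace Z⁺).toReal + (posTrace Z⁻).toReal := by
    rw [traceNorm_eq_posPart_add_negPart hZ]
    exact ENNReal.toReal_add
      ((isTraceClass_iff_of_isPositive hp).1 (hf.posPart hZ)).ne
      ((isTraceClass_iff_of_isPositive hn).1 (hf.negPart hZ)).ne
  rw [hΛ.map_eq_posPart_sub_negPart ht hZ hf, sub_apply, inner_sub_right, Complex.sub_re, h5,
    add_mul]
  rw [abs_le]
  constructor <;> linarith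

/-- The trace norm controls the expectation along a semigroup trajectory uniformly in time. -/
lemma abs_re_inner_map_add_sub_le (hΛ : IsQuantumDynamicalSemigroup Λ) (hs : 0 ≤ s) (ht : 0 ≤ t)
    {Z : E →L[ℂ] E} (hZ : IsSelfAdjoint Z) (hf : IsTraceClass Z)
    (hd : IsTraceClass (Λ t Z - Z)) (ψ : E) :
    |(⟪ψ, Λ (s + t) Z ψ⟫_ℂ).re - (⟪ψ, Λ s Z ψ⟫_ℂ).re| ≤
      (traceNorm (Λ t Z - Z)).toReal * ‖ψ‖ ^ 2 := by
  have h := hΛ.abs_re_inner_map_le hs ((hΛ.isSelfAdjoint ht hZ hf).sub hZ) hd ψ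
  rw [hΛ.map_sub hs (hΛ.isTraceClass t ht Z hf) hf, ← hΛ.map_add_time s t hs ht Z hf] at h
  simpa [inner_sub_right] using h

lemma eventually_isTraceClass_sub (hΛ : IsQuantumDynamicalSemigroup Λ) {Z : E →L[ℂ] E}
    (hf : IsTraceClass Z) : ∀ᶠ h in 𝓝[>] (0 : ℝ), IsTraceClass (Λ h Z - Z) :=
  (hΛ.strongly_continuous Z hf).eventually_lt_const ENNReal.zero_lt_top

lemma tendsto_toReal_traceNorm_sub (hΛ : IsQuantumDynamicalSemigroup Λ) {Z : E →L[ℂ] E}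
    (hf : IsTraceClass Z) :
    Tendsto (fun h => (traceNorm (Λ h Z - Z)).toReal) (𝓝[>] 0) (𝓝 0) := by
  exact (ENNReal.tendsto_toReal ENNReal.zero_ne_top).comp (hΛ.strongly_continuous Z hf)

lemma continuousOn_re_inner_map (hΛ : IsQuantumDynamicalSemigroup Λ) {Z : E →L[ℂ] E}
    (hZ : IsSelfAdjoint Z) (hf : IsTraceClass Z) (ψ : E) :
    ContinuousOn (fun t => (⟪ψ, Λ t Z ψ⟫_ℂ).re) (Set.Ici 0) := by
  rw [Metric.continuousOn_iff]
  intro t ht ε hε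
  have h1 := (hΛ.tendsto_toReal_traceNorm_sub hf).mul_const (‖ψ‖ ^ 2)
  rw [zero_mul] at h1
  obtain ⟨δ, hδ, H⟩ := mem_nhdsGT_iff_exists_Ioo_subset.1
    ((h1.eventually_lt_const hε).and (hΛ.eventually_isTraceClass_sub hf))
  -- Since `Λ_b - Λ_a = Λ_a(Λ_{b-a} - 1)`, right continuity at time zero controls increments on both
  -- sides of `t` uniformly.
  have key : ∀ a b : ℝ, 0 ≤ a → a < b → b - a < δ →
      |(⟪ψ, Λ b Z ψ⟫_ℂ).re - (⟪ψ, Λ a Z ψ⟫_ℂ).re| < ε := by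
    intro a b ha hab hb
    have hm := H (show b - a ∈ Set.Ioo 0 δ from ⟨by linarith, hb⟩)
    have := hΛ.abs_re_inner_map_add_sub_le ha (by linarith : 0 ≤ b - a) hZ hf hm.2 ψ
    rw [add_sub_cancel] at this
    exact this.trans_lt hm.1
  refine ⟨δ, hδ, fun s hs hst => ?_⟩
  rw [Real.dist_eq] at hst ⊢
  rcases lt_trichotomy s t with h | h | h
  · rw [abs_sub_comm]
    refine key s t hs h ?_
    rw [abs_sub_comm, abs_of_pos (by linarith)] at hst
    exact hst
  · simpa [h] using hε
  · refine key t s ht h ?_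
    rwa [abs_of_pos (by linarith)] at hst

/-- The left derivative in time of an expectation value, for an observable trajectory starting at a
point of the domain of the generator. -/
lemma hasDerivWithinAt_re_inner_map (hΛ : IsQuantumDynamicalSemigroup Λ) {X L : E →L[ℂ] E}
    (hX : IsSelfAdjoint X) (hXf : IsTraceClass X) (hL : IsSelfAdjoint L) (hLf : IsTraceClass L)
    (hgen : Tendsto (fun h : ℝ => traceNorm ((h : ℂ)⁻¹ • (Λ h X - X) - L)) (𝓝[>] 0) (𝓝 0))
    (ht : 0 < t) (ψ : E) :
    HasDerivWithinAt (fun s => (⟪ψ, Λ s X ψ⟫_ℂ).re) (⟪ψ, Λ t L ψ⟫_ℂ).re (Set.Iio t) t := by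
  rw [hasDerivWithinAt_iff_tendsto_slope' (by simp)]
  have hsub : Tendsto (fun s => t - s) (𝓝[<] t) (𝓝[>] 0) := by
    refine tendsto_nhdsWithin_iff.2 ⟨?_, ?_⟩
    · have : Tendsto (fun s => t - s) (𝓝 t) (𝓝 (t - t)) := tendsto_const_nhds.sub tendsto_id
      rw [sub_self] at this
      exact this.mono_left nhdsWithin_le_nhds
    · filter_upwards [self_mem_nhdsWithin] with s hs
      simpa using hs
  -- With `h = t - s`, the left difference quotient is `Λ_s` applied to `h⁻¹(Λ_h X - X) = (h⁻¹(Λ_h X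
  -- - X) - L) + L`. The second summand converges by continuity in `s`, and the first vanishes by
  -- the uniform bound in trace norm.
  have hcont : Tendsto (fun s => (⟪ψ, Λ s L ψ⟫_ℂ).re) (𝓝[<] t) (𝓝 (⟪ψ, Λ t L ψ⟫_ℂ).re) := by
    have h1 := (hΛ.continuousOn_re_inner_map hL hLf ψ).continuousAt (Ici_mem_nhds ht)
    exact h1.tendsto.mono_left nhdsWithin_le_nhds
  have hrem : Tendsto (fun s => (⟪ψ, Λ s (((t - s : ℝ) : ℂ)⁻¹ • (Λ (t - s) X - X) - L) ψ⟫_ℂ).re)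
      (𝓝[<] t) (𝓝 0) := by
    have h1 := (((ENNReal.tendsto_toReal ENNReal.zero_ne_top).comp hgen).comp hsub).mul_const
      (‖ψ‖ ^ 2)
    rw [ENNReal.toReal_zero, zero_mul] at h1
    refine squeeze_zero_norm' ?_ h1
    filter_upwards [hsub.eventually (hgen.eventually_lt_const ENNReal.zero_lt_top),
      Ioo_mem_nhdsLT ht] with s hs hs2
    have hsa : IsSelfAdjoint (((t - s : ℝ) : ℂ)⁻¹ • (Λ (t - s) X - X) - L) := by
      refine IsSelfAdjoint.sub (IsSelfAdjoint.smul ?_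
        ((hΛ.isSelfAdjoint (by linarith [hs2.2]) hX hXf).sub hX)) hL
      rw [← Complex.ofReal_inv, IsSelfAdjoint, Complex.star_def, Complex.conj_ofReal]
    exact hΛ.abs_re_inner_map_le hs2.1.le hsa hs ψ
  have hsum := hrem.add hcont
  rw [zero_add] at hsum
  refine hsum.congr' ?_
  filter_upwards [hsub.eventually (hgen.eventually_lt_const ENNReal.zero_lt_top),
    hsub.eventually (hΛ.eventually_isTraceClass_sub hXf), Ioo_mem_nhdsLT ht] with s hs hs1 hs2
  have hne : t - s ≠ 0 := by linarith [hs2.2]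
  have h0 : 0 ≤ t - s := by linarith [hs2.2]
  have e1 := hΛ.map_add s hs2.1.le _ _ hs hLf
  rw [sub_add_cancel, hΛ.map_smul s hs2.1.le _ _ hs1,
    hΛ.map_sub hs2.1.le (hΛ.isTraceClass _ h0 X hXf) hXf, ← hΛ.map_add_time s _ hs2.1.le h0 X hXf,
    add_sub_cancel] at e1
  rw [← Complex.add_re, ← inner_add_right, ← add_apply, ← e1, ← Complex.ofReal_inv, smul_apply,
    inner_smul_right, Complex.re_ofReal_mul, sub_apply, inner_sub_right, Complex.sub_re,
    slope_def_field]
  rw [← neg_sub t s, div_neg, ← neg_div, neg_sub, inv_mul_eq_div]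

end IsQuantumDynamicalSemigroup

end Semigroup

/-! ### The evolved sesquilinear form on rank one operators -/

section Forms

variable {E : Type*} [NormedAddCommGroup E] [InnerProductSpace ℂ E] [CompleteSpace E]
  {Λ : ℝ → (E →L[ℂ] E) → (E →L[ℂ] E)} {t : ℝ}

/-- The sesquilinear form `(φ, φ') ↦ ⟨ψ, Λ_t(|φ⟩⟨φ'|) ψ⟩`. -/
def evolvedForm (Λ : ℝ → (E →L[ℂ] E) → (E →L[ℂ] E)) (t : ℝ) (ψ x y : E) : ℂ :=
  ⟪ψ, Λ t (InnerProductSpace.rankOne ℂ x y) ψ⟫_ℂ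

lemma isTraceClass_rankOne (x y : E) : IsTraceClass (InnerProductSpace.rankOne ℂ x y) :=
  (isFiniteRank_rankOne x y).isTraceClass

namespace IsQuantumDynamicalSemigroup

lemma evolvedForm_add_left (hΛ : IsQuantumDynamicalSemigroup Λ) (ht : 0 ≤ t) (ψ x x' y : E) :
    evolvedForm Λ t ψ (x + x') y = evolvedForm Λ t ψ x y + evolvedForm Λ t ψ x' y := by
  unfold evolvedForm
  rw [_root_.map_add, add_apply, hΛ.map_add t ht _ _ (isTraceClass_rankOne _ _)
    (isTraceClass_rankOne _ _), add_apply, inner_add_right]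

lemma evolvedForm_add_right (hΛ : IsQuantumDynamicalSemigroup Λ) (ht : 0 ≤ t) (ψ x y y' : E) :
    evolvedForm Λ t ψ x (y + y') = evolvedForm Λ t ψ x y + evolvedForm Λ t ψ x y' := by
  unfold evolvedForm
  rw [_root_.map_add, hΛ.map_add t ht _ _ (isTraceClass_rankOne _ _)
    (isTraceClass_rankOne _ _), add_apply, inner_add_right]

lemma evolvedForm_smul_left (hΛ : IsQuantumDynamicalSemigroup Λ) (ht : 0 ≤ t) (ψ : E) (c : ℂ)
    (x y : E) : evolvedForm Λ t ψ (c • x) y = c * evolvedForm Λ t ψ x y := by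
  unfold evolvedForm
  rw [_root_.map_smul, smul_apply, hΛ.map_smul t ht _ _ (isTraceClass_rankOne _ _),
    smul_apply, inner_smul_right]

lemma evolvedForm_smul_right (hΛ : IsQuantumDynamicalSemigroup Λ) (ht : 0 ≤ t) (ψ : E) (c : ℂ)
    (x y : E) : evolvedForm Λ t ψ x (c • y) = starRingEnd ℂ c * evolvedForm Λ t ψ x y := by
  unfold evolvedForm
  rw [ContinuousLinearMap.map_smulₛₗ, hΛ.map_smul t ht _ _ (isTraceClass_rankOne _ _),
    smul_apply, inner_smul_right]

lemma isPositive_map_rankOne (hΛ : IsQuantumDynamicalSemigroup Λ) (ht : 0 ≤ t) (x : E) :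
    (Λ t (InnerProductSpace.rankOne ℂ x x)).IsPositive :=
  hΛ.isPositive ht (InnerProductSpace.isPositive_rankOne_self x) (isTraceClass_rankOne x x)

lemma re_evolvedForm_self_nonneg (hΛ : IsQuantumDynamicalSemigroup Λ) (ht : 0 ≤ t) (ψ x : E) :
    0 ≤ (evolvedForm Λ t ψ x x).re :=
  IsPositive.re_nonneg (hΛ.isPositive_map_rankOne ht x) ψ

lemma re_evolvedForm_self_le (hΛ : IsQuantumDynamicalSemigroup Λ) (ht : 0 ≤ t) (ψ x : E) :
    (evolvedForm Λ t ψ x x).re ≤ ‖x‖ ^ 2 * ‖ψ‖ ^ 2 := by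
  have h := hΛ.re_inner_map_le ht (InnerProductSpace.isPositive_rankOne_self x)
    (isTraceClass_rankOne x x) ψ
  rwa [posTrace_rankOne_self, ENNReal.toReal_ofReal (by positivity)] at h

lemma norm_evolvedForm_self_le (hΛ : IsQuantumDynamicalSemigroup Λ) (ht : 0 ≤ t) (ψ x : E) :
    ‖evolvedForm Λ t ψ x x‖ ≤ ‖x‖ ^ 2 * ‖ψ‖ ^ 2 := by
  have h := IsPositive.inner_eq_re (hΛ.isPositive_map_rankOne ht x) ψ
  have h2 := hΛ.re_evolvedForm_self_nonneg ht ψ x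
  have h3 := hΛ.re_evolvedForm_self_le ht ψ x
  unfold evolvedForm at *
  rw [h, Complex.norm_real, Real.norm_of_nonneg h2]
  exact h3

lemma evolvedForm_polarization (hΛ : IsQuantumDynamicalSemigroup Λ) (ht : 0 ≤ t) (ψ x y : E) :
    4 * evolvedForm Λ t ψ x y =
      evolvedForm Λ t ψ (x + (1 : ℂ) • y) (x + (1 : ℂ) • y)
      - evolvedForm Λ t ψ (x + (-1 : ℂ) • y) (x + (-1 : ℂ) • y)
      + Complex.I * evolvedForm Λ t ψ (x + Complex.I • y) (x + Complex.I • y)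
      - Complex.I * evolvedForm Λ t ψ (x + (-Complex.I) • y) (x + (-Complex.I) • y) := by
  simp only [hΛ.evolvedForm_add_left ht, hΛ.evolvedForm_add_right ht, hΛ.evolvedForm_smul_left ht,
    hΛ.evolvedForm_smul_right ht, map_neg, map_one, Complex.conj_I]
  ring_nf
  simp only [Complex.I_sq]
  ring

/-- Polarization reduces the off-diagonal values to four diagonal ones, which positivity controls;
the parallelogram law sums them in pairs. -/
lemma norm_evolvedForm_le_add (hΛ : IsQuantumDynamicalSemigroup Λ) (ht : 0 ≤ t) (ψ x y : E) :
    ‖evolvedForm Λ t ψ x y‖ ≤ (‖x‖ ^ 2 + ‖y‖ ^ 2) * ‖ψ‖ ^ 2 := by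
  have key : ∀ c : ℂ, ‖c‖ = 1 → ‖evolvedForm Λ t ψ (x + c • y) (x + c • y)‖ +
      ‖evolvedForm Λ t ψ (x + (-c) • y) (x + (-c) • y)‖ ≤
        2 * (‖x‖ ^ 2 + ‖y‖ ^ 2) * ‖ψ‖ ^ 2 := fun c hc => by
    have h1 := hΛ.norm_evolvedForm_self_le ht ψ (x + c • y)
    have h2 := hΛ.norm_evolvedForm_self_le ht ψ (x + (-c) • y)
    have h3 := parallelogram_law_with_norm ℂ x (c • y)
    rw [norm_smul, hc, one_mul] at h3
    rw [neg_smul, ← sub_eq_add_neg] at h2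
    rw [neg_smul, ← sub_eq_add_neg]
    calc _ ≤ (‖x + c • y‖ ^ 2 + ‖x - c • y‖ ^ 2) * ‖ψ‖ ^ 2 := by linarith
      _ = _ := by rw [h3]
  have h1 := key 1 (by simp)
  have h2 := key Complex.I (by simp)
  have h3 : ‖4 * evolvedForm Λ t ψ x y‖ = 4 * ‖evolvedForm Λ t ψ x y‖ := by simp
  have h4 := hΛ.evolvedForm_polarization ht ψ x y
  rw [h4] at h3
  have h5 := norm_sub_le (evolvedForm Λ t ψ (x + (1 : ℂ) • y) (x + (1 : ℂ) • y)
      - evolvedForm Λ t ψ (x + (-1 : ℂ) • y) (x + (-1 : ℂ) • y)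
      + Complex.I * evolvedForm Λ t ψ (x + Complex.I • y) (x + Complex.I • y))
      (Complex.I * evolvedForm Λ t ψ (x + (-Complex.I) • y) (x + (-Complex.I) • y))
  have h6 := norm_add_le (evolvedForm Λ t ψ (x + (1 : ℂ) • y) (x + (1 : ℂ) • y)
      - evolvedForm Λ t ψ (x + (-1 : ℂ) • y) (x + (-1 : ℂ) • y))
      (Complex.I * evolvedForm Λ t ψ (x + Complex.I • y) (x + Complex.I • y))
  have h7 := norm_sub_le (evolvedForm Λ t ψ (x + (1 : ℂ) • y) (x + (1 : ℂ) • y))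
      (evolvedForm Λ t ψ (x + (-1 : ℂ) • y) (x + (-1 : ℂ) • y))
  simp only [norm_mul, Complex.norm_I, one_mul] at h5 h6
  linarith

lemma norm_evolvedForm_le (hΛ : IsQuantumDynamicalSemigroup Λ) (ht : 0 ≤ t) (ψ x y : E) :
    ‖evolvedForm Λ t ψ x y‖ ≤ 2 * ‖ψ‖ ^ 2 * ‖x‖ * ‖y‖ := by
  rcases eq_or_ne x 0 with rfl | hx
  · have := hΛ.evolvedForm_smul_left ht ψ 0 0 y
    rw [zero_smul, zero_mul] at this
    simp [this]
  rcases eq_or_ne y 0 with rfl | hy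
  · have := hΛ.evolvedForm_smul_right ht ψ 0 x 0
    rw [zero_smul, map_zero, zero_mul] at this
    simp [this]
  have hx' := norm_pos_iff.2 hx
  have hy' := norm_pos_iff.2 hy
  -- Normalizing both vectors turns the sum of squares into a product, and `1² + 1²` is the constant
  -- `2`.
  have h := hΛ.norm_evolvedForm_le_add ht ψ (((‖x‖⁻¹ : ℝ) : ℂ) • x) (((‖y‖⁻¹ : ℝ) : ℂ) • y)
  rw [hΛ.evolvedForm_smul_left ht, hΛ.evolvedForm_smul_right ht, Complex.conj_ofReal] at h
  simp only [norm_mul, norm_smul, Complex.norm_real, norm_inv, norm_norm, inv_mul_cancel₀ hx'.ne',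
    inv_mul_cancel₀ hy'.ne'] at h
  have h2 : ‖evolvedForm Λ t ψ x y‖ =
      ‖x‖ * ‖y‖ * (‖x‖⁻¹ * (‖y‖⁻¹ * ‖evolvedForm Λ t ψ x y‖)) := by
    field_simp
  rw [h2]
  calc _ ≤ ‖x‖ * ‖y‖ * ((1 ^ 2 + 1 ^ 2) * ‖ψ‖ ^ 2) := by gcongr
    _ = _ := by ring

/-- The real part of `evolvedForm` as a bounded real bilinear form. -/
lemma exists_realForm [NormedSpace ℝ E] [IsScalarTower ℝ ℂ E]
    (hΛ : IsQuantumDynamicalSemigroup Λ) (ht : 0 ≤ t) (ψ : E) :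
    ∃ B : E →L[ℝ] E →L[ℝ] ℝ, ∀ x y, B x y = (evolvedForm Λ t ψ x y).re := by
  refine ⟨LinearMap.mkContinuous₂ (LinearMap.mk₂ ℝ (fun x y => (evolvedForm Λ t ψ x y).re)
    ?_ ?_ ?_ ?_) (2 * ‖ψ‖ ^ 2) ?_, fun x y => rfl⟩
  · intro x x' y
    rw [hΛ.evolvedForm_add_left ht, Complex.add_re]
  · intro c x y
    rw [← smul_one_smul ℂ c x, hΛ.evolvedForm_smul_left ht]
    simp
  · intro x y y'
    rw [hΛ.evolvedForm_add_right ht, Complex.add_re]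
  · intro c x y
    rw [← smul_one_smul ℂ c y, hΛ.evolvedForm_smul_right ht]
    simp
  · intro x y
    exact (Complex.abs_re_le_norm _).trans (hΛ.norm_evolvedForm_le ht ψ x y)

/-- Makes the cocycle phases of the Weyl relations invisible. -/
lemma evolvedForm_self_smul (hΛ : IsQuantumDynamicalSemigroup Λ) (ht : 0 ≤ t) (ψ x : E) {c : ℂ}
    (hc : ‖c‖ = 1) : evolvedForm Λ t ψ (c • x) (c • x) = evolvedForm Λ t ψ x x := by
  rw [hΛ.evolvedForm_smul_left ht, hΛ.evolvedForm_smul_right ht, ← mul_assoc, Complex.mul_conj,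
    Complex.normSq_eq_norm_sq, hc]
  simp

lemma abs_re_evolvedForm_self_sub_le (hΛ : IsQuantumDynamicalSemigroup Λ) (ht : 0 ≤ t)
    (ψ x y : E) : |(evolvedForm Λ t ψ x x).re - (evolvedForm Λ t ψ y y).re| ≤
      2 * ‖ψ‖ ^ 2 * (‖x‖ + ‖y‖) * ‖x - y‖ := by
  have h1 := hΛ.evolvedForm_add_left ht ψ (x - y) y x
  have h2 := hΛ.evolvedForm_add_right ht ψ y (x - y) y
  rw [sub_add_cancel] at h1 h2
  rw [h1, h2, Complex.add_re, Complex.add_re, ← add_assoc, add_sub_cancel_right]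
  have h3 := (Complex.abs_re_le_norm _).trans (hΛ.norm_evolvedForm_le ht ψ (x - y) x)
  have h4 := (Complex.abs_re_le_norm _).trans (hΛ.norm_evolvedForm_le ht ψ y (x - y))
  refine (abs_add_le _ _).trans ?_
  linarith

lemma continuousOn_re_evolvedForm (hΛ : IsQuantumDynamicalSemigroup Λ) (ψ x : E) :
    ContinuousOn (fun t => (evolvedForm Λ t ψ x x).re) (Set.Ici 0) :=
  hΛ.continuousOn_re_inner_map (InnerProductSpace.isPositive_rankOne_self x).isSelfAdjoint
    (isTraceClass_rankOne x x) ψ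

end IsQuantumDynamicalSemigroup

end Forms

/-! ### The generator in terms of evolved forms -/

section DiffusionForms

variable {n : ℕ} {Λ : ℝ → (StateSpace n →L[ℂ] StateSpace n) → (StateSpace n →L[ℂ] StateSpace n)}
  {t : ℝ}

lemma isFiniteRank_generator (φ ψ : StateSpace n) : IsFiniteRank (generator φ ψ) := by
  refine IsFiniteRank.smul (isFiniteRank_sum _ _ fun j _ => ?_) _
  exact ((isFiniteRank_rankOne _ _).sub ((isFiniteRank_rankOne _ _).smul _)).add
    (isFiniteRank_rankOne _ _)

lemma isSelfAdjoint_generator_self (φ : StateSpace n) : IsSelfAdjoint (generator φ φ) := by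
  unfold generator
  refine IsSelfAdjoint.smul (by simp [IsSelfAdjoint]) (isSelfAdjoint_sum _ fun j _ => ?_)
  rw [IsSelfAdjoint, star_add, star_sub, star_smul]
  simp only [ContinuousLinearMap.star_eq_adjoint, InnerProductSpace.adjoint_rankOne]
  rw [Complex.star_def, Complex.conj_ofNat]
  abel

lemma IsQuantumDynamicalSemigroup.inner_map_sum {E ι : Type*} [NormedAddCommGroup E]
    [InnerProductSpace ℂ E] [CompleteSpace E] {Λ : ℝ → (E →L[ℂ] E) → (E →L[ℂ] E)}
    (hΛ : IsQuantumDynamicalSemigroup Λ) (ht : 0 ≤ t) (ψ : E) (s : Finset ι)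
    (A : ι → E →L[ℂ] E) (hA : ∀ i ∈ s, IsFiniteRank (A i)) :
    ⟪ψ, Λ t (∑ i ∈ s, A i) ψ⟫_ℂ = ∑ i ∈ s, ⟪ψ, Λ t (A i) ψ⟫_ℂ := by
  classical
  induction s using Finset.induction_on with
  | empty =>
    have h := hΛ.map_smul t ht 0 0 isFiniteRank_zero.isTraceClass
    rw [zero_smul, zero_smul] at h
    simp [h]
  | insert a s ha ih =>
    rw [Finset.sum_insert ha, Finset.sum_insert ha, hΛ.map_add t ht _ _ (hA a (by simp)).isTraceClass
      (isFiniteRank_sum _ _ fun i hi => hA i (by simp [hi])).isTraceClass, add_apply,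
      inner_add_right, ih fun i hi => hA i (by simp [hi])]

lemma IsQuantumDynamicalSemigroup.inner_map_generator (hΛ : IsQuantumDynamicalSemigroup Λ)
    (ht : 0 ≤ t) (ψ φ : StateSpace n) :
    ⟪ψ, Λ t (generator φ φ) ψ⟫_ℂ = -(1 / 4) * ∑ j, (evolvedForm Λ t ψ (opR j (opR j φ)) φ
      - 2 * evolvedForm Λ t ψ (opR j φ) (opR j φ) + evolvedForm Λ t ψ φ (opR j (opR j φ))) := by
  have hf : ∀ j : Fin n ⊕ Fin n, IsFiniteRank (ketBra (opR j (opR j φ)) φ -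
      (2 : ℂ) • ketBra (opR j φ) (opR j φ) + ketBra φ (opR j (opR j φ))) := fun j =>
    ((isFiniteRank_rankOne _ _).sub ((isFiniteRank_rankOne _ _).smul _)).add
      (isFiniteRank_rankOne _ _)
  unfold generator
  rw [hΛ.map_smul t ht _ _ (isFiniteRank_sum _ _ fun j _ => hf j).isTraceClass, smul_apply,
    inner_smul_right, hΛ.inner_map_sum ht ψ _ _ fun j _ => hf j]
  congr 1
  refine Finset.sum_congr rfl fun j _ => ?_
  rw [hΛ.map_add t ht _ _ ((isFiniteRank_rankOne _ _).sub
    ((isFiniteRank_rankOne _ _).smul _)).isTraceClass (isTraceClass_rankOne _ _),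
    hΛ.map_sub ht (isTraceClass_rankOne _ _) ((isTraceClass_rankOne _ _).smul _),
    hΛ.map_smul t ht _ _ (isTraceClass_rankOne _ _)]
  simp only [add_apply, sub_apply, smul_apply, inner_add_right, inner_sub_right, inner_smul_right]
  rfl

lemma IsQuantumDiffusionSemigroup.hasDerivWithinAt_re_evolvedForm
    (hΛ : IsQuantumDiffusionSemigroup Λ) (ht : 0 < t) (ψ φ : StateSpace n) (hφ : InDomRSq φ) :
    HasDerivWithinAt (fun s => (evolvedForm Λ s ψ φ φ).re)
      (-(1 / 4) * ∑ j, ((evolvedForm Λ t ψ (opR j (opR j φ)) φ).re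
        - 2 * (evolvedForm Λ t ψ (opR j φ) (opR j φ)).re
        + (evolvedForm Λ t ψ φ (opR j (opR j φ))).re)) (Set.Iio t) t := by
  have h := hΛ.hasDerivWithinAt_re_inner_map
    (InnerProductSpace.isPositive_rankOne_self φ).isSelfAdjoint (isTraceClass_rankOne φ φ)
    (isSelfAdjoint_generator_self φ) (isFiniteRank_generator φ φ).isTraceClass
    (hΛ.generator_eq φ φ hφ hφ) ht ψ
  rw [hΛ.inner_map_generator ht.le] at h
  convert h using 1
  · rfl
  rw [show (-(1 / 4) : ℂ) = ((-(1 / 4) : ℝ) : ℂ) by push_cast; rfl, Complex.re_ofReal_mul,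
    Complex.re_sum]
  congr 1
  refine Finset.sum_congr rfl fun j _ => ?_
  simp

end DiffusionForms

/-! ### A maximum principle on unbounded space -/

section MaximumPrinciple

/-- If `a` were positive, `x` would also be a local minimum, so `f` would be locally constant and
`a` would vanish. -/
lemma nonpos_of_isLocalMax {f g : ℝ → ℝ} {a x : ℝ} (hf : ∀ s, HasDerivAt f (g s) s)
    (hg : HasDerivAt g a x) (hmax : IsLocalMax f x) : a ≤ 0 := by
  by_contra! ha
  have hdf : deriv f = g := funext fun s => (hf s).deriv
  have hmin : IsLocalMin f x := by
    refine isLocalMin_of_deriv_deriv_pos ?_ ?_ (hf x).continuousAt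
    · rwa [hdf, hg.deriv]
    · rw [hdf]
      exact hmax.hasDerivAt_eq_zero (hf x)
  have hconst : f =ᶠ[𝓝 x] fun _ => f x := by
    filter_upwards [hmin, hmax] with s h1 h2 using le_antisymm h2 h1
  have hg0 : g =ᶠ[𝓝 x] fun _ => 0 := by
    have := hconst.deriv
    rwa [hdf, show deriv (fun _ : ℝ => f x) = fun _ => 0 from funext fun _ => deriv_const _ _]
      at this
  exact ha.ne (((hasDerivAt_const x (0 : ℝ)).congr_of_eventuallyEq hg0).unique hg)

lemma nonneg_of_le_left {f : ℝ → ℝ} {b t : ℝ} (hf : HasDerivWithinAt f b (Set.Iio t) t)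
    (h : ∀ᶠ s in 𝓝[<] t, f s ≤ f t) : 0 ≤ b := by
  rw [hasDerivWithinAt_iff_tendsto_slope' (by simp)] at hf
  refine ge_of_tendsto hf ?_
  filter_upwards [h, self_mem_nhdsWithin] with s hs hst
  rw [slope_def_field]
  exact div_nonneg_of_nonpos (by linarith) (by linarith [Set.mem_Iio.1 hst])

variable {ι E : Type*} [Fintype ι] [NormedAddCommGroup E] [InnerProductSpace ℝ E]

/-- `u` solves `∂ₜ u = ¼ ∑ⱼ ∂²u/∂ζⱼ²` at `(t, w)`; the time derivative is one-sided. -/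
def IsHeatSolutionAt (ζ : ι → E) (u : ℝ → E → ℝ) (t : ℝ) (w : E) : Prop :=
  ∃ a : ι → ℝ, (∀ j, ∃ g : ℝ → ℝ, (∀ s, HasDerivAt (fun s : ℝ => u t (w + s • ζ j)) (g s) s) ∧
    HasDerivAt g (a j) 0) ∧ HasDerivWithinAt (fun s => u s w) (1 / 4 * ∑ j, a j) (Set.Iio t) t

lemma IsHeatSolutionAt.sub {ζ : ι → E} {u v : ℝ → E → ℝ} {t : ℝ} {w : E}
    (hu : IsHeatSolutionAt ζ u t w) (hv : IsHeatSolutionAt ζ v t w) :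
    IsHeatSolutionAt ζ (fun t w => u t w - v t w) t w := by
  obtain ⟨a, ha, ha'⟩ := hu
  obtain ⟨b, hb, hb'⟩ := hv
  refine ⟨fun j => a j - b j, fun j => ?_, ?_⟩
  · obtain ⟨g, hg, hg'⟩ := ha j
    obtain ⟨k, hk, hk'⟩ := hb j
    exact ⟨fun s => g s - k s, fun s => (hg s).sub (hk s), hg'.sub hk'⟩
  · rw [Finset.sum_sub_distrib, mul_sub]
    exact ha'.sub hb'

/-- The weak maximum principle on `[0, T] × E` for functions bounded above. -/
theorem le_of_isHeatSolutionAt [FiniteDimensional ℝ E] {ζ : ι → E} (hζ : ∀ j, ‖ζ j‖ = 1)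
    {v : ℝ → E → ℝ} {T C η : ℝ} (hT : 0 ≤ T)
    (hcont : ContinuousOn (fun p : ℝ × E => v p.1 p.2) (Set.Icc 0 T ×ˢ Set.univ))
    (hheat : ∀ t ∈ Set.Ioc 0 T, ∀ w, IsHeatSolutionAt ζ v t w)
    (hC : ∀ t ∈ Set.Icc 0 T, ∀ w, v t w ≤ C) (h0 : ∀ w, v 0 w ≤ η) (w : E) : v T w ≤ η := by
  set N : ℝ := (Fintype.card ι : ℝ)
  -- The quadratic penalty replaces compactness of the space, and the linear one in time makes the
  -- heat inequality strict. Both disappear as `ε → 0`.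
  have key : ∀ ε > 0, v T w - ε * (‖w‖ ^ 2 + (N + 1) * T) ≤ η := by
    intro ε hε
    by_contra! hlt
    -- On and beyond radius `R` the penalty pushes the bounded function below `η`, so a maximum
    -- above `η` is attained at an interior point of the ball.
    obtain ⟨R, hR, hwR, hCR⟩ : ∃ R : ℝ, 0 ≤ R ∧ ‖w‖ ≤ R ∧ C - η ≤ ε * R ^ 2 := by
      refine ⟨‖w‖ + |C - η| / ε + 1, by positivity, ?_, ?_⟩
      · linarith [show 0 ≤ |C - η| / ε by positivity]
      · have h1 : 1 ≤ ‖w‖ + |C - η| / ε + 1 := by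
          linarith [show 0 ≤ |C - η| / ε by positivity, norm_nonneg w]
        calc C - η ≤ ε * (|C - η| / ε) := by
              rw [mul_div_cancel₀ _ hε.ne']; exact le_abs_self _
          _ ≤ ε * (‖w‖ + |C - η| / ε + 1) := by
              gcongr; linarith [norm_nonneg w]
          _ ≤ _ := by gcongr; exact le_self_pow₀ h1 two_ne_zero
    set f : ℝ × E → ℝ := fun p => v p.1 p.2 - ε * (‖p.2‖ ^ 2 + (N + 1) * p.1) with hf
    have hK : IsCompact (Set.Icc 0 T ×ˢ Metric.closedBall (0 : E) R) :=
      isCompact_Icc.prod (isCompact_closedBall 0 R)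
    have hfc : ContinuousOn f (Set.Icc 0 T ×ˢ Metric.closedBall (0 : E) R) := by
      refine (hcont.mono (Set.prod_mono le_rfl (Set.subset_univ _))).sub ?_
      fun_prop
    obtain ⟨⟨t, x⟩, ⟨ht, hx⟩, hmax⟩ := hK.exists_isMaxOn
      ⟨(T, w), ⟨hT, le_rfl⟩, by simpa using hwR⟩ hfc
    have hbig : η < f (t, x) :=
      hlt.trans_le (hmax ⟨⟨hT, le_rfl⟩, by simpa using hwR⟩ : f (T, w) ≤ f (t, x))
    simp only at ht hx
    have hN : 0 ≤ N := Nat.cast_nonneg _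
    have ht0 : 0 < t := by
      rcases ht.1.eq_or_lt with h | h
      · exfalso
        rw [← h] at hbig
        have := h0 x
        have h2 : 0 ≤ ε * (‖x‖ ^ 2 + (N + 1) * 0) := by positivity
        simp only [hf] at hbig
        linarith
      · exact h
    have hxR : ‖x‖ < R := by
      by_contra! hge
      have h1 := hC t ht x
      have h2 : ε * R ^ 2 ≤ ε * (‖x‖ ^ 2 + (N + 1) * t) := by
        have : R ^ 2 ≤ ‖x‖ ^ 2 := by gcongr
        have : 0 ≤ (N + 1) * t := by positivity
        gcongr
        linarith
      simp only [hf] at hbig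
      linarith
    obtain ⟨a, ha, ha'⟩ := hheat t ⟨ht0, ht.2⟩ x
    have hspace : ∀ j, a j ≤ 2 * ε := by
      intro j
      obtain ⟨g, hg, hg'⟩ := ha j
      have hq : ∀ s : ℝ, ‖x + s • ζ j‖ ^ 2 = ‖x‖ ^ 2 + 2 * s * ⟪x, ζ j⟫_ℝ + s ^ 2 := fun s => by
        rw [norm_add_sq_real, inner_smul_right, norm_smul, hζ j, mul_one, Real.norm_eq_abs, sq_abs]
        ring
      have hfd : ∀ s, HasDerivAt (fun s : ℝ => f (t, x + s • ζ j))
          (g s - ε * (2 * ⟪x, ζ j⟫_ℝ + 2 * s)) s := fun s => by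
        simp only [hf, hq]
        refine (hg s).sub ?_
        have h1 : HasDerivAt (fun s : ℝ => ε * (‖x‖ ^ 2 + 2 * s * ⟪x, ζ j⟫_ℝ + s ^ 2 + (N + 1) * t))
            (ε * (0 + 2 * 1 * ⟪x, ζ j⟫_ℝ + 2 * s + 0)) s := by
          refine HasDerivAt.const_mul _ (HasDerivAt.add (HasDerivAt.add (HasDerivAt.add
            (hasDerivAt_const _ _) (((hasDerivAt_id s).const_mul 2).mul_const _)) ?_)
            (hasDerivAt_const _ _))
          simpa using hasDerivAt_pow 2 s
        exact h1.congr_deriv (by ring)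
      have hgd : HasDerivAt (fun s => g s - ε * (2 * ⟪x, ζ j⟫_ℝ + 2 * s)) (a j - 2 * ε) 0 := by
        refine hg'.sub ?_
        have h1 : HasDerivAt (fun s : ℝ => ε * (2 * ⟪x, ζ j⟫_ℝ + 2 * s)) (ε * (2 * 1)) 0 :=
          ((((hasDerivAt_id (0 : ℝ)).const_mul 2).const_add _)).const_mul _
        exact h1.congr_deriv (by ring)
      have hloc : IsLocalMax (fun s : ℝ => f (t, x + s • ζ j)) 0 := by
        have hc : Tendsto (fun s : ℝ => ‖x + s • ζ j‖) (𝓝 0) (𝓝 ‖x + (0 : ℝ) • ζ j‖) :=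
          (Continuous.tendsto (by fun_prop) 0)
        rw [zero_smul, add_zero] at hc
        filter_upwards [hc.eventually_lt_const hxR] with s hs
        have := hmax (show (t, x + s • ζ j) ∈ Set.Icc 0 T ×ˢ Metric.closedBall (0 : E) R from
          ⟨ht, by simpa using hs.le⟩)
        simpa using this
      linarith [nonpos_of_isLocalMax hfd hgd hloc]
    have htime : ε * (N + 1) ≤ 1 / 4 * ∑ j, a j := by
      have h1 : HasDerivWithinAt (fun s => f (s, x)) (1 / 4 * ∑ j, a j - ε * (N + 1))
          (Set.Iio t) t := by
        refine ha'.sub ?_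
        have h2 : HasDerivAt (fun s : ℝ => ε * (‖x‖ ^ 2 + (N + 1) * s)) (ε * ((N + 1) * 1)) t :=
          ((((hasDerivAt_id t).const_mul _).const_add _)).const_mul _
        rw [mul_one] at h2
        exact h2.hasDerivWithinAt
      -- The maximum may occur at the final time `T`, so only earlier times are compared; this is
      -- why a left derivative is the right notion.
      have h2 := nonneg_of_le_left h1 (by
        filter_upwards [Ioo_mem_nhdsLT ht0] with s hs
        exact hmax ⟨⟨hs.1.le, hs.2.le.trans ht.2⟩, hx⟩)
      linarith
    have hsum : ∑ j, a j ≤ N * (2 * ε) := by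
      have := Finset.sum_le_sum fun j (_ : j ∈ Finset.univ) => hspace j
      simpa [N] using this
    -- The two bounds would give `ε (N + 1) ≤ ε N / 2`, which is absurd.
    nlinarith
  have hlim : Tendsto (fun ε => v T w - ε * (‖w‖ ^ 2 + (N + 1) * T)) (𝓝[>] 0)
      (𝓝 (v T w - 0 * (‖w‖ ^ 2 + (N + 1) * T))) :=
    (Continuous.tendsto (by fun_prop) 0).mono_left nhdsWithin_le_nhds
  rw [zero_mul, sub_zero] at hlim
  exact le_of_tendsto hlim (by filter_upwards [self_mem_nhdsWithin] with ε hε using key ε hε)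

end MaximumPrinciple

/-! ### Pointwise estimates for the heat kernel -/

section NormedHeatKernel

variable {E : Type*} [NormedAddCommGroup E]

/-- The kernel of `exp (t Δ / 4)` on a Euclidean space of dimension `2 n`. -/
def heatKernel (n : ℕ) (τ : ℝ) (x : E) : ℝ :=
  ((Real.pi * τ) ^ n)⁻¹ * Real.exp (-(‖x‖ ^ 2 / τ))

variable {n : ℕ} {τ : ℝ}

lemma heatKernel_nonneg (hτ : 0 < τ) (x : E) : 0 ≤ heatKernel n τ x := by
  unfold heatKernel
  positivity

lemma heatKernel_le (hτ : 0 < τ) (x : E) : heatKernel n τ x ≤ ((Real.pi * τ) ^ n)⁻¹ := by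
  unfold heatKernel
  refine mul_le_of_le_one_right (by positivity) (Real.exp_le_one_iff.2 ?_)
  have : 0 ≤ ‖x‖ ^ 2 / τ := by positivity
  linarith

lemma abs_heatKernel_le (hτ : 0 < τ) (x : E) : |heatKernel n τ x| ≤ ((Real.pi * τ) ^ n)⁻¹ := by
  rw [abs_of_nonneg (heatKernel_nonneg hτ x)]
  exact heatKernel_le hτ x

lemma continuous_heatKernel : Continuous (heatKernel n τ : E → ℝ) := by
  unfold heatKernel
  fun_prop

lemma norm_sq_div_mul_heatKernel_le (hτ : 0 < τ) (x : E) :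
    ‖x‖ ^ 2 / τ * heatKernel n τ x ≤ ((Real.pi * τ) ^ n)⁻¹ := by
  unfold heatKernel
  set a := ‖x‖ ^ 2 / τ
  have h1 : a * Real.exp (-a) ≤ 1 := by
    rw [Real.exp_neg, ← div_eq_mul_inv, div_le_one (Real.exp_pos _)]
    linarith [Real.add_one_le_exp a]
  calc a * (((Real.pi * τ) ^ n)⁻¹ * Real.exp (-a))
      = ((Real.pi * τ) ^ n)⁻¹ * (a * Real.exp (-a)) := by ring
    _ ≤ ((Real.pi * τ) ^ n)⁻¹ * 1 := by gcongr
    _ = _ := mul_one _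

/-- Half of the Gaussian exponent absorbs the quadratic factor, through `b e^{-b} ≤ 1`. Integrated,
this bounds the second moment of the kernel by a multiple of `τ` without computing it. -/
lemma norm_sq_mul_heatKernel_le (hτ : 0 < τ) (x : E) :
    ‖x‖ ^ 2 * heatKernel n τ x ≤ 2 ^ (n + 1) * τ * heatKernel n (2 * τ) x := by
  unfold heatKernel
  set b := ‖x‖ ^ 2 / (2 * τ) with hb
  have h0 : ‖x‖ ^ 2 = 2 * τ * b := by rw [hb]; field_simp
  have h2 : ‖x‖ ^ 2 / τ = b + b := by rw [hb]; field_simp; ring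
  have h1 : b * Real.exp (-b) ≤ 1 := by
    rw [Real.exp_neg, ← div_eq_mul_inv, div_le_one (Real.exp_pos _)]
    linarith [Real.add_one_le_exp b]
  rw [h2, neg_add, Real.exp_add, h0, mul_left_comm Real.pi 2 τ, mul_pow 2, mul_inv]
  calc 2 * τ * b * (((Real.pi * τ) ^ n)⁻¹ * (Real.exp (-b) * Real.exp (-b)))
      = 2 * τ * (((Real.pi * τ) ^ n)⁻¹ * Real.exp (-b)) * (b * Real.exp (-b)) := by ring
    _ ≤ 2 * τ * (((Real.pi * τ) ^ n)⁻¹ * Real.exp (-b)) * 1 := by gcongr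
    _ = _ := by
      rw [pow_succ]
      field_simp

lemma hasDerivAt_heatKernel_time (hτ : 0 < τ) (x : E) :
    HasDerivAt (fun τ => heatKernel n τ x) ((‖x‖ ^ 2 / τ ^ 2 - n / τ) * heatKernel n τ x) τ := by
  unfold heatKernel
  have h1 : HasDerivAt (fun τ : ℝ => ((Real.pi * τ) ^ n)⁻¹)
      (-(n * (Real.pi * τ) ^ (n - 1) * (Real.pi * 1)) / ((Real.pi * τ) ^ n) ^ 2) τ :=
    (((hasDerivAt_id τ).const_mul Real.pi).pow n).inv (show (Real.pi * τ) ^ n ≠ 0 by positivity)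
  have h2 : HasDerivAt (fun τ : ℝ => Real.exp (-(‖x‖ ^ 2 / τ)))
      (Real.exp (-(‖x‖ ^ 2 / τ)) * (-((0 * τ - ‖x‖ ^ 2 * 1) / τ ^ 2))) τ :=
    (((hasDerivAt_const τ (‖x‖ ^ 2)).div (hasDerivAt_id τ) hτ.ne').neg).exp
  refine (h1.mul h2).congr_deriv ?_
  rcases n with _ | m
  · simp
    ring
  · rw [Nat.add_sub_cancel]
    have : (Real.pi * τ) ≠ 0 := by positivity
    rw [pow_succ]
    field_simp
    ring

lemma abs_heatKernel_time_deriv_le (hτ : 0 < τ) (x : E) :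
    |(‖x‖ ^ 2 / τ ^ 2 - n / τ) * heatKernel n τ x| ≤ (n + 1) / τ * ((Real.pi * τ) ^ n)⁻¹ := by
  have h1 := norm_sq_div_mul_heatKernel_le (n := n) hτ x
  have h2 := heatKernel_le (n := n) hτ x
  have h3 := heatKernel_nonneg (n := n) hτ x
  have e1 : (‖x‖ ^ 2 / τ ^ 2 - n / τ) * heatKernel n τ x
      = 1 / τ * (‖x‖ ^ 2 / τ * heatKernel n τ x) - n / τ * heatKernel n τ x := by
    field_simp
  rw [e1]
  have a1 : 1 / τ * (‖x‖ ^ 2 / τ * heatKernel n τ x) ≤ 1 / τ * ((Real.pi * τ) ^ n)⁻¹ := by gcongr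
  have a2 : n / τ * heatKernel n τ x ≤ n / τ * ((Real.pi * τ) ^ n)⁻¹ := by gcongr
  have a3 : 0 ≤ 1 / τ * (‖x‖ ^ 2 / τ * heatKernel n τ x) := by positivity
  have a4 : 0 ≤ n / τ * heatKernel n τ x := by positivity
  have a5 : (n + 1) / τ * ((Real.pi * τ) ^ n)⁻¹
      = 1 / τ * ((Real.pi * τ) ^ n)⁻¹ + n / τ * ((Real.pi * τ) ^ n)⁻¹ := by ring
  rw [a5, abs_le]
  constructor <;> linarith

end NormedHeatKernel

/-! ### The classical heat flow and comparison with it -/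

section HeatKernel

variable {ι E : Type*} [Fintype ι] [NormedAddCommGroup E] [InnerProductSpace ℝ E]

variable {n : ℕ} {τ : ℝ}

lemma norm_add_smul_sq {ζ : E} (hζ : ‖ζ‖ = 1) (x : E) (s : ℝ) :
    ‖x + s • ζ‖ ^ 2 = ‖x‖ ^ 2 + 2 * s * ⟪x, ζ⟫_ℝ + s ^ 2 := by
  rw [norm_add_sq_real, inner_smul_right, norm_smul, hζ, mul_one, Real.norm_eq_abs, sq_abs]
  ring

lemma inner_add_smul_self {ζ : E} (hζ : ‖ζ‖ = 1) (x : E) (s : ℝ) :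
    ⟪x + s • ζ, ζ⟫_ℝ = ⟪x, ζ⟫_ℝ + s := by
  rw [inner_add_left, real_inner_smul_left, real_inner_self_eq_norm_sq, hζ]
  ring

lemma hasDerivAt_heatKernel_space {ζ : E} (hζ : ‖ζ‖ = 1) (x : E) (s : ℝ) :
    HasDerivAt (fun s : ℝ => heatKernel n τ (x + s • ζ))
      (-(2 * ⟪x + s • ζ, ζ⟫_ℝ / τ) * heatKernel n τ (x + s • ζ)) s := by
  unfold heatKernel
  simp only [norm_add_smul_sq hζ, inner_add_smul_self hζ]
  have h1 : HasDerivAt (fun s : ℝ => ‖x‖ ^ 2 + 2 * s * ⟪x, ζ⟫_ℝ + s ^ 2)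
      (2 * 1 * ⟪x, ζ⟫_ℝ + (2 : ℕ) * s ^ (2 - 1)) s :=
    ((((hasDerivAt_id s).const_mul 2).mul_const _).const_add _).add (hasDerivAt_pow 2 s)
  refine (((h1.div_const τ).neg.exp).const_mul _).congr_deriv ?_
  simp only [Pi.neg_apply]
  push_cast
  ring

lemma hasDerivAt_heatKernel_space_deriv {ζ : E} (hζ : ‖ζ‖ = 1) (x : E) (s : ℝ) :
    HasDerivAt (fun s : ℝ => -(2 * ⟪x + s • ζ, ζ⟫_ℝ / τ) * heatKernel n τ (x + s • ζ))
      ((4 * ⟪x + s • ζ, ζ⟫_ℝ ^ 2 / τ ^ 2 - 2 / τ) * heatKernel n τ (x + s • ζ)) s := by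
  have h1 : HasDerivAt (fun s : ℝ => -(2 * ⟪x + s • ζ, ζ⟫_ℝ / τ)) (-(2 * 1 / τ)) s := by
    simp only [inner_add_smul_self hζ]
    exact ((((hasDerivAt_id s).const_add _).const_mul 2).div_const τ).neg
  refine (h1.mul (hasDerivAt_heatKernel_space hζ x s)).congr_deriv ?_
  ring

lemma inner_sq_le_norm_sq {ζ : E} (hζ : ‖ζ‖ = 1) (x : E) : ⟪x, ζ⟫_ℝ ^ 2 ≤ ‖x‖ ^ 2 := by
  have := abs_real_inner_le_norm x ζ
  rw [hζ, mul_one] at this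
  rw [← sq_abs]
  gcongr

lemma abs_heatKernel_space_deriv_le (hτ : 0 < τ) {ζ : E} (hζ : ‖ζ‖ = 1) (x : E) :
    |-(2 * ⟪x, ζ⟫_ℝ / τ) * heatKernel n τ x| ≤ (1 / τ + 1) * ((Real.pi * τ) ^ n)⁻¹ := by
  have h1 := norm_sq_div_mul_heatKernel_le (n := n) hτ x
  have h2 := heatKernel_le (n := n) hτ x
  have h3 := heatKernel_nonneg (n := n) hτ x
  have h4 := inner_sq_le_norm_sq hζ x
  have h5 : |-(2 * ⟪x, ζ⟫_ℝ / τ)| ≤ 1 / τ + ‖x‖ ^ 2 / τ := by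
    rw [abs_neg, abs_div, abs_of_pos hτ, ← add_div]
    gcongr
    rw [abs_le]
    constructor <;> nlinarith [sq_nonneg (⟪x, ζ⟫_ℝ - 1), sq_nonneg (⟪x, ζ⟫_ℝ + 1)]
  rw [abs_mul, abs_of_nonneg h3]
  calc _ ≤ (1 / τ + ‖x‖ ^ 2 / τ) * heatKernel n τ x := by gcongr
    _ = 1 / τ * heatKernel n τ x + ‖x‖ ^ 2 / τ * heatKernel n τ x := by ring
    _ ≤ 1 / τ * ((Real.pi * τ) ^ n)⁻¹ + ((Real.pi * τ) ^ n)⁻¹ := by gcongr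
    _ = _ := by ring

lemma abs_heatKernel_space_deriv_deriv_le (hτ : 0 < τ) {ζ : E} (hζ : ‖ζ‖ = 1) (x : E) :
    |(4 * ⟪x, ζ⟫_ℝ ^ 2 / τ ^ 2 - 2 / τ) * heatKernel n τ x| ≤
      6 / τ * ((Real.pi * τ) ^ n)⁻¹ := by
  have h1 := norm_sq_div_mul_heatKernel_le (n := n) hτ x
  have h2 := heatKernel_le (n := n) hτ x
  have h3 := heatKernel_nonneg (n := n) hτ x
  have h4 := inner_sq_le_norm_sq hζ x
  have h5 : |4 * ⟪x, ζ⟫_ℝ ^ 2 / τ ^ 2 - 2 / τ| ≤ 4 / τ * (‖x‖ ^ 2 / τ) + 2 / τ := by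
    have e1 : 4 * ⟪x, ζ⟫_ℝ ^ 2 / τ ^ 2 = 4 / τ * (⟪x, ζ⟫_ℝ ^ 2 / τ) := by field_simp
    have e2 : 4 / τ * (⟪x, ζ⟫_ℝ ^ 2 / τ) ≤ 4 / τ * (‖x‖ ^ 2 / τ) := by gcongr
    have e3 : 0 ≤ 4 / τ * (⟪x, ζ⟫_ℝ ^ 2 / τ) := by positivity
    have e4 : 0 < 2 / τ := by positivity
    rw [e1, abs_le]
    constructor <;> linarith
  rw [abs_mul, abs_of_nonneg h3]
  calc _ ≤ (4 / τ * (‖x‖ ^ 2 / τ) + 2 / τ) * heatKernel n τ x := by gcongr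
    _ = 4 / τ * (‖x‖ ^ 2 / τ * heatKernel n τ x) + 2 / τ * heatKernel n τ x := by ring
    _ ≤ 4 / τ * ((Real.pi * τ) ^ n)⁻¹ + 2 / τ * ((Real.pi * τ) ^ n)⁻¹ := by gcongr
    _ = _ := by ring

variable [FiniteDimensional ℝ E] [MeasurableSpace E] [BorelSpace E]

lemma integral_heatKernel (hn : Module.finrank ℝ E = 2 * n) (hτ : 0 < τ) :
    ∫ x : E, heatKernel n τ x = 1 := by
  unfold heatKernel
  rw [integral_const_mul]
  have h := GaussianFourier.integral_rexp_neg_mul_sq_norm (V := E) (b := τ⁻¹) (by positivity)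
  rw [hn] at h
  have e : ∀ x : E, -(‖x‖ ^ 2 / τ) = -τ⁻¹ * ‖x‖ ^ 2 := fun x => by ring
  simp_rw [e]
  rw [h, show ((2 * n : ℕ) : ℝ) / 2 = (n : ℝ) by push_cast; ring, Real.rpow_natCast, div_inv_eq_mul]
  exact inv_mul_cancel₀ (by positivity)

/-- A non-integrable function has integral `0` by convention, whereas this one has integral `1`. -/
lemma integrable_heatKernel (hn : Module.finrank ℝ E = 2 * n) (hτ : 0 < τ) :
    Integrable (heatKernel n τ : E → ℝ) := by
  by_contra h
  have := integral_heatKernel hn hτ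
  rw [integral_undef h] at this
  exact zero_ne_one this

lemma integrable_mul_of_abs_le {f u : E → ℝ} (hu : Integrable u) (hf : Continuous f) {B : ℝ}
    (hB : ∀ x, |f x| ≤ B) : Integrable fun y => f y * u y :=
  hu.bdd_mul hf.aestronglyMeasurable (Eventually.of_forall hB)

/-- The kernel derivatives are bounded uniformly in the space variable, so a constant multiple of
`|u|` dominates. -/
lemma hasDerivAt_integral_mul {F F' : ℝ → E → ℝ} {u : E → ℝ} (hu : Integrable u) {s₀ B C : ℝ}
    {S : Set ℝ} (hS : S ∈ 𝓝 s₀) (hF : ∀ s, Continuous (F s)) (hF₀ : ∀ x, |F s₀ x| ≤ B)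
    (hF' : Continuous (F' s₀)) (hC : ∀ s ∈ S, ∀ x, |F' s x| ≤ C)
    (hd : ∀ s ∈ S, ∀ x, HasDerivAt (fun s => F s x) (F' s x) s) :
    HasDerivAt (fun s => ∫ y, F s y * u y) (∫ y, F' s₀ y * u y) s₀ := by
  refine (hasDerivAt_integral_of_dominated_loc_of_deriv_le (F := fun s y => F s y * u y)
    (F' := fun s y => F' s y * u y) (bound := fun y => C * |u y|)
    hS ?_ ?_ ?_ ?_ ?_ ?_).2
  · exact Eventually.of_forall fun s =>
      (hF s).aestronglyMeasurable.mul hu.aestronglyMeasurable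
  · exact integrable_mul_of_abs_le hu (hF s₀) hF₀
  · exact hF'.aestronglyMeasurable.mul hu.aestronglyMeasurable
  · refine Eventually.of_forall fun y s hs => ?_
    rw [norm_mul]
    exact mul_le_mul_of_nonneg_right (hC s hs y) (norm_nonneg _)
  · exact hu.abs.const_mul C
  · exact Eventually.of_forall fun y s hs => (hd s hs y).mul_const (u y)

/-- The solution of the heat equation with initial value `u`. -/
def heatFlow (n : ℕ) (u : E → ℝ) (τ : ℝ) (w : E) : ℝ := ∫ y, heatKernel n τ (w - y) * u y

/-- Differentiating under the integral reduces this to the kernel. There, Parseval for the `ζ j` and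
the count `2n` give `¼ ∑ⱼ (4⟨x, ζⱼ⟩²/τ² - 2/τ) = ‖x‖²/τ² - n/τ`, the factor of the time derivative.
-/
lemma isHeatSolutionAt_heatFlow (hn : Fintype.card ι = 2 * n) {ζ : ι → E} (hζ : ∀ j, ‖ζ j‖ = 1)
    (hζ' : ∀ x, ∑ j, ⟪x, ζ j⟫_ℝ ^ 2 = ‖x‖ ^ 2) {u : E → ℝ} (hu : Integrable u) {δ t : ℝ}
    (hδ : 0 < t + δ) (w : E) :
    IsHeatSolutionAt ζ (fun t w => heatFlow n u (t + δ) w) t w := by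
  unfold heatFlow
  set τ := t + δ
  refine ⟨fun j => ∫ y, (4 * ⟪w - y, ζ j⟫_ℝ ^ 2 / τ ^ 2 - 2 / τ) * heatKernel n τ (w - y) * u y,
    fun j => ⟨fun s => ∫ y, (-(2 * ⟪w - y + s • ζ j, ζ j⟫_ℝ / τ) *
      heatKernel n τ (w - y + s • ζ j)) * u y, fun s => ?_, ?_⟩, ?_⟩
  · simp only [add_sub_right_comm w]
    refine hasDerivAt_integral_mul (F := fun s y => heatKernel n τ (w - y + s • ζ j)) hu
      (univ_mem) (fun s => continuous_heatKernel.comp (by fun_prop))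
      (fun y => abs_heatKernel_le hδ _) ?_
      (fun s _ y => abs_heatKernel_space_deriv_le hδ (hζ j) _)
      (fun s _ y => hasDerivAt_heatKernel_space (hζ j) _ s)
    exact Continuous.mul (by fun_prop) (continuous_heatKernel.comp (by fun_prop))
  · have h := hasDerivAt_integral_mul (s₀ := 0)
      (F := fun s y => -(2 * ⟪w - y + s • ζ j, ζ j⟫_ℝ / τ) * heatKernel n τ (w - y + s • ζ j)) hu
      (univ_mem) (fun s => Continuous.mul (by fun_prop) (continuous_heatKernel.comp (by fun_prop)))
      (fun y => abs_heatKernel_space_deriv_le hδ (hζ j) _)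
      (Continuous.mul (by fun_prop) (continuous_heatKernel.comp (by fun_prop)))
      (fun s _ y => abs_heatKernel_space_deriv_deriv_le hδ (hζ j) _)
      (fun s _ y => hasDerivAt_heatKernel_space_deriv (hζ j) _ s)
    simpa only [zero_smul, add_zero] using h
  · have h : HasDerivAt (fun τ => ∫ y, heatKernel n τ (w - y) * u y)
        (∫ y, (‖w - y‖ ^ 2 / τ ^ 2 - n / τ) * heatKernel n τ (w - y) * u y) τ := by
      refine hasDerivAt_integral_mul (F := fun τ y => heatKernel n τ (w - y))
        (F' := fun τ y => (‖w - y‖ ^ 2 / τ ^ 2 - n / τ) * heatKernel n τ (w - y)) hu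
        -- The bound on the time derivative decreases in time, so its value at `τ / 2` serves on the
        -- whole neighbourhood `(τ / 2, ∞)`.
        (C := (n + 1) / (τ / 2) * ((Real.pi * (τ / 2)) ^ n)⁻¹)
        (Ioi_mem_nhds (show τ / 2 < τ by linarith))
        (fun s => continuous_heatKernel.comp (by fun_prop))
        (fun y => abs_heatKernel_le hδ _)
        (Continuous.mul (by fun_prop) (continuous_heatKernel.comp (by fun_prop)))
        (fun s hs y => ?_) (fun s hs y => hasDerivAt_heatKernel_time ?_ _)
      · have hs' : τ / 2 < s := hs
        have h0 : 0 < s := by linarith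
        refine (abs_heatKernel_time_deriv_le h0 _).trans ?_
        have : 0 < τ / 2 := by linarith
        gcongr
      · have hs' : τ / 2 < s := hs
        linarith
    have hsum : 1 / 4 * ∑ j, ∫ y, (4 * ⟪w - y, ζ j⟫_ℝ ^ 2 / τ ^ 2 - 2 / τ) *
        heatKernel n τ (w - y) * u y =
        ∫ y, (‖w - y‖ ^ 2 / τ ^ 2 - n / τ) * heatKernel n τ (w - y) * u y := by
      rw [← integral_finsetSum, ← integral_const_mul]
      · refine integral_congr_ae (Eventually.of_forall fun y => ?_)
        simp only
        rw [← Finset.sum_mul, ← Finset.sum_mul, Finset.sum_sub_distrib, ← Finset.sum_div,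
          ← Finset.mul_sum, hζ', Finset.sum_const, Finset.card_univ, hn]
        simp only [nsmul_eq_mul]
        push_cast
        ring
      · intro j _
        exact integrable_mul_of_abs_le hu
          (Continuous.mul (by fun_prop) (continuous_heatKernel.comp (by fun_prop)))
          fun y => abs_heatKernel_space_deriv_deriv_le hδ (hζ j) _
    rw [hsum]
    exact (h.comp_add_const t δ).hasDerivWithinAt

lemma continuousOn_heatFlow {u : E → ℝ} (hu : Integrable u) {δ : ℝ} (hδ : 0 < δ) (T : ℝ) :
    ContinuousOn (fun p : ℝ × E => heatFlow n u (p.1 + δ) p.2) (Set.Icc 0 T ×ˢ Set.univ) := by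
  unfold heatFlow
  have hpos : ∀ p ∈ Set.Icc 0 T ×ˢ (Set.univ : Set E), δ ≤ p.1 + δ := fun p hp => by
    have : 0 ≤ p.1 := hp.1.1
    linarith
  refine continuousOn_of_dominated (bound := fun y => ((Real.pi * δ) ^ n)⁻¹ * |u y|) ?_ ?_ ?_ ?_
  · exact fun p _ => (continuous_heatKernel.comp (by fun_prop)).aestronglyMeasurable.mul
      hu.aestronglyMeasurable
  · refine fun p hp => Eventually.of_forall fun y => ?_
    rw [norm_mul]
    refine mul_le_mul_of_nonneg_right ((abs_heatKernel_le (hδ.trans_le (hpos p hp)) _).trans ?_)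
      (norm_nonneg _)
    have := hpos p hp
    gcongr
  · exact hu.abs.const_mul _
  · refine Eventually.of_forall fun y => ContinuousOn.mul ?_ continuousOn_const
    unfold heatKernel
    refine ContinuousOn.mul (ContinuousOn.inv₀ (by fun_prop) fun p hp => ?_)
      (ContinuousOn.rexp (ContinuousOn.neg (ContinuousOn.div (by fun_prop) (by fun_prop)
        fun p hp => ?_)))
    · have := hδ.trans_le (hpos p hp)
      positivity
    · exact (hδ.trans_le (hpos p hp)).ne'

lemma heatFlow_nonneg {u : E → ℝ} (h0 : ∀ y, 0 ≤ u y) (hτ : 0 < τ) (w : E) :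
    0 ≤ heatFlow n u τ w :=
  integral_nonneg fun y => mul_nonneg (heatKernel_nonneg hτ _) (h0 y)

lemma heatFlow_le {u : E → ℝ} (hu : Integrable u) (h0 : ∀ y, 0 ≤ u y) (hτ : 0 < τ) (w : E) :
    heatFlow n u τ w ≤ ((Real.pi * τ) ^ n)⁻¹ * ∫ y, u y := by
  unfold heatFlow
  rw [← integral_const_mul]
  refine integral_mono (integrable_mul_of_abs_le hu (continuous_heatKernel.comp (by fun_prop))
    fun y => abs_heatKernel_le hτ _) (hu.const_mul _) fun y => ?_
  exact mul_le_mul_of_nonneg_right (heatKernel_le hτ _) (h0 y)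

/-- The kernel has mass one, so the difference is an average of `u w - u (w - y)`; the quadratic
part of the modulus is absorbed by the kernel at time `2τ`, again of mass one. -/
lemma sub_heatFlow_le (hn : Module.finrank ℝ E = 2 * n) {u : E → ℝ} (hu : Integrable u)
    {ε C : ℝ} (hC : ∀ w y, |u (w - y) - u w| ≤ ε + C * ‖y‖ ^ 2) (hC0 : 0 ≤ C) (hτ : 0 < τ) (w : E) :
    u w - heatFlow n u τ w ≤ ε + C * (2 ^ (n + 1) * τ) := by
  have hK := integrable_heatKernel (E := E) hn hτ
  have hK2 := integrable_heatKernel (E := E) hn (by positivity : 0 < 2 * τ)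
  have e1 : heatFlow n u τ w = ∫ y, heatKernel n τ y * u (w - y) := by
    unfold heatFlow
    rw [← integral_sub_left_eq_self _ volume w]
    simp
  have e2 : u w = ∫ y : E, heatKernel n τ y * u w := by
    rw [integral_mul_const, integral_heatKernel hn hτ, one_mul]
  have e3 : ε + C * (2 ^ (n + 1) * τ) =
      ∫ y : E, (ε * heatKernel n τ y + C * (2 ^ (n + 1) * τ) * heatKernel n (2 * τ) y) := by
    rw [integral_add (hK.const_mul _) (hK2.const_mul _), integral_const_mul, integral_const_mul,
      integral_heatKernel hn hτ, integral_heatKernel hn (by positivity), mul_one, mul_one]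
  have hi : Integrable fun y => heatKernel n τ y * u (w - y) :=
    integrable_mul_of_abs_le (hu.comp_sub_left w) continuous_heatKernel
      (fun y => abs_heatKernel_le hτ y)
  rw [e1, e3]
  conv_lhs => rw [e2]
  rw [← integral_sub (hK.mul_const _) hi]
  refine integral_mono ((hK.mul_const _).sub hi) ((hK.const_mul _).add (hK2.const_mul _))
    fun y => ?_
  have h1 := (abs_le.1 (hC w y)).1
  have h2 := norm_sq_mul_heatKernel_le (n := n) hτ y
  have h3 := heatKernel_nonneg (n := n) hτ y
  simp only
  calc heatKernel n τ y * u w - heatKernel n τ y * u (w - y)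
      = heatKernel n τ y * (u w - u (w - y)) := by ring
    _ ≤ heatKernel n τ y * (ε + C * ‖y‖ ^ 2) := by gcongr; linarith
    _ = ε * heatKernel n τ y + C * (‖y‖ ^ 2 * heatKernel n τ y) := by ring
    _ ≤ ε * heatKernel n τ y + C * (2 ^ (n + 1) * τ * heatKernel n (2 * τ) y) := by gcongr
    _ = _ := by ring

/-- A bounded nonnegative solution of the heat equation with uniformly continuous integrable initial
value decays like the heat kernel. -/
theorem le_heatKernel_mul_integral (hcard : Fintype.card ι = 2 * n)
    (hn : Module.finrank ℝ E = 2 * n) {ζ : ι → E}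
    (hζ : ∀ j, ‖ζ j‖ = 1) (hζ' : ∀ x, ∑ j, ⟪x, ζ j⟫_ℝ ^ 2 = ‖x‖ ^ 2)
    {u : ℝ → E → ℝ} {T B : ℝ} (hT : 0 < T)
    (hcont : ContinuousOn (fun p : ℝ × E => u p.1 p.2) (Set.Icc 0 T ×ˢ Set.univ))
    (hheat : ∀ t ∈ Set.Ioc 0 T, ∀ w, IsHeatSolutionAt ζ u t w)
    (hB : ∀ t ∈ Set.Icc 0 T, ∀ w, u t w ≤ B) (h0 : ∀ w, 0 ≤ u 0 w) (hu : Integrable (u 0))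
    (huc : ∀ ε > 0, ∃ C, 0 ≤ C ∧ ∀ w y, |u 0 (w - y) - u 0 w| ≤ ε + C * ‖y‖ ^ 2) (w : E) :
    u T w ≤ ((Real.pi * T) ^ n)⁻¹ * ∫ y, u 0 y := by
  have hM : 0 ≤ ∫ y, u 0 y := integral_nonneg h0
  refine le_of_forall_pos_le_add fun ε hε => ?_
  obtain ⟨C, hC0, hC⟩ := huc ε hε
  -- Comparison with the flow run ahead by `δ` avoids the singular kernel at time zero, at the cost
  -- of a small initial error. The difference is bounded above because the heat flow is nonnegative.
  have key : ∀ δ > 0, u T w ≤ ((Real.pi * T) ^ n)⁻¹ * (∫ y, u 0 y) + (ε + C * (2 ^ (n + 1) * δ)) := by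
    intro δ hδ
    have h1 := le_of_isHeatSolutionAt hζ (v := fun t w => u t w - heatFlow n (u 0) (t + δ) w)
      (C := B) (η := ε + C * (2 ^ (n + 1) * δ)) hT.le
      (hcont.sub (continuousOn_heatFlow hu hδ T))
      (fun t ht w => (hheat t ht w).sub (isHeatSolutionAt_heatFlow hcard hζ hζ' hu
        (by linarith [ht.1]) w))
      (fun t ht w => by
        have := heatFlow_nonneg (n := n) h0 (by linarith [ht.1] : 0 < t + δ) w
        linarith [hB t ht w])
      (fun w => by
        rw [zero_add]
        exact sub_heatFlow_le hn hu hC hC0 hδ w) w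
    have h2 := heatFlow_le (n := n) hu h0 (by linarith : 0 < T + δ) w
    have h3 : ((Real.pi * (T + δ)) ^ n)⁻¹ * ∫ y, u 0 y ≤ ((Real.pi * T) ^ n)⁻¹ * ∫ y, u 0 y := by
      gcongr
      linarith
    linarith
  have hlim : Tendsto (fun δ => ((Real.pi * T) ^ n)⁻¹ * (∫ y, u 0 y) + (ε + C * (2 ^ (n + 1) * δ)))
      (𝓝[>] 0) (𝓝 (((Real.pi * T) ^ n)⁻¹ * (∫ y, u 0 y) + (ε + C * (2 ^ (n + 1) * 0)))) :=
    (Continuous.tendsto (by fun_prop) 0).mono_left nhdsWithin_le_nhds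
  rw [mul_zero, mul_zero, add_zero] at hlim
  exact ge_of_tendsto hlim (by filter_upwards [self_mem_nhdsWithin] with δ hδ using key δ hδ)

end HeatKernel

/-! ### Weyl relations and smooth compactly supported vectors -/

section Weyl

variable {n : ℕ}

lemma weyl_coeFn (z : PhaseSpace n) (φ : StateSpace n) :
    weyl z φ =ᵐ[volume] fun x => weylPhase z x * φ (x + pos z) := by
  have h1 := (memLp_weyl z (Lp.compMeasurePreservingₗᵢ ℂ (fun x => x + pos z)
    (measurePreserving_add_right volume (pos z)) φ)).coeFn_toLp
  have h2 := Lp.coeFn_compMeasurePreserving φ (measurePreserving_add_right volume (pos z))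
  filter_upwards [h1, h2] with x hx hx2
  exact hx.trans (congrArg (weylPhase z x * ·) hx2)

lemma weyl_coeFn_of_ae_eq (z : PhaseSpace n) {φ : StateSpace n} {f : Config n → ℂ}
    (h : φ =ᵐ[volume] f) :
    weyl z φ =ᵐ[volume] fun x => weylPhase z x * f (x + pos z) := by
  filter_upwards [weyl_coeFn z φ,
    (measurePreserving_add_right volume (pos z)).quasiMeasurePreserving.ae_eq_comp h] with x hx hx2
  rw [hx]
  congr 1

lemma norm_weyl (z : PhaseSpace n) (φ : StateSpace n) : ‖weyl z φ‖ = ‖φ‖ :=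
  ((phaseMul z).comp (Lp.compMeasurePreservingₗᵢ ℂ (fun x => x + pos z)
    (measurePreserving_add_right volume (pos z)))).norm_map φ

lemma pos_add (z w : PhaseSpace n) : pos (z + w) = pos z + pos w := rfl
lemma mom_add (z w : PhaseSpace n) : mom (z + w) = mom z + mom w := rfl
lemma pos_smul (c : ℝ) (z : PhaseSpace n) : pos (c • z) = c • pos z := rfl
lemma mom_smul (c : ℝ) (z : PhaseSpace n) : mom (c • z) = c • mom z := rfl

/-- The cocycle of the Weyl relations. -/
def weylCocycle (z w : PhaseSpace n) : ℂ :=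
  Complex.exp (-Complex.I * (((⟪mom w, pos z⟫_ℝ - ⟪mom z, pos w⟫_ℝ) / 2 : ℝ) : ℂ))

lemma norm_weylCocycle (z w : PhaseSpace n) : ‖weylCocycle z w‖ = 1 := by
  rw [weylCocycle, Complex.norm_exp]
  simp

lemma weyl_weyl (z w : PhaseSpace n) (φ : StateSpace n) :
    weyl z (weyl w φ) = weylCocycle z w • weyl (z + w) φ := by
  apply Lp.ext
  filter_upwards [weyl_coeFn_of_ae_eq z (weyl_coeFn w φ),
    Lp.coeFn_smul (weylCocycle z w) (weyl (z + w) φ), weyl_coeFn (z + w) φ] with x h1 h2 h3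
  rw [h1, h2, Pi.smul_apply, h3, smul_eq_mul, pos_add, add_assoc, ← mul_assoc, ← mul_assoc]
  congr 1
  unfold weylPhase weylCocycle
  rw [← Complex.exp_add, ← Complex.exp_add, ← mul_add, ← mul_add, ← Complex.ofReal_add,
    ← Complex.ofReal_add]
  congr 3
  simp only [mom_add, pos_add, inner_add_left, inner_add_right]
  ring

lemma weyl_smul_add (s r : ℝ) (z : PhaseSpace n) (φ : StateSpace n) :
    weyl ((s + r) • z) φ = weyl (s • z) (weyl (r • z) φ) := by
  rw [weyl_weyl, add_smul]
  have : weylCocycle (s • z) (r • z) = 1 := by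
    unfold weylCocycle
    simp only [mom_smul, pos_smul, real_inner_smul_left, real_inner_smul_right]
    rw [show s * (r * ⟪mom z, pos z⟫_ℝ) - r * (s * ⟪mom z, pos z⟫_ℝ) = 0 by ring]
    simp
  rw [this, one_smul]

lemma weyl_zero (φ : StateSpace n) : weyl 0 φ = φ := by
  apply Lp.ext
  filter_upwards [weyl_coeFn 0 φ] with x hx
  rw [hx]
  have h1 : pos (0 : PhaseSpace n) = 0 := rfl
  have h2 : mom (0 : PhaseSpace n) = 0 := rfl
  simp [weylPhase, h1, h2]

/-- The class of a smooth compactly supported function. -/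
def IsTestVector (φ : StateSpace n) : Prop :=
  ∃ f : Config n → ℂ, φ =ᵐ[volume] f ∧ HasCompactSupport f ∧ ContDiff ℝ (⊤ : ℕ∞) f

lemma dense_isTestVector : Dense {φ : StateSpace n | IsTestVector φ} :=
  Lp.dense_hasCompactSupport_contDiff (by simp)

lemma contDiff_weylPhase (z : PhaseSpace n) : ContDiff ℝ (⊤ : ℕ∞) (weylPhase z) := by
  unfold weylPhase
  have h : ContDiff ℝ (⊤ : ℕ∞) fun x : Config n => ⟪mom z, x⟫_ℝ + ⟪mom z, pos z⟫_ℝ / 2 :=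
    (contDiff_const.inner ℝ contDiff_id).add contDiff_const
  exact (contDiff_const.mul (Complex.ofRealCLM.contDiff.comp h)).cexp

lemma IsTestVector.weyl {φ : StateSpace n} (h : IsTestVector φ) (z : PhaseSpace n) :
    IsTestVector (weyl z φ) := by
  obtain ⟨f, hf, hc, hd⟩ := h
  refine ⟨_, weyl_coeFn_of_ae_eq z hf, ?_, ?_⟩
  · exact (hc.comp_homeomorph (Homeomorph.addRight (pos z))).mul_left
  · exact (contDiff_weylPhase z).mul (hd.comp (by fun_prop))

/-- A family of functions, smooth in parameter and variable with uniformly compact supports, is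
differentiable in `L²`. -/
lemma hasDerivAt_of_contDiff {Φ : ℝ → StateSpace n} {G : ℝ × Config n → ℂ} {K : Set (Config n)}
    (hK : IsCompact K) (hG : ContDiff ℝ (⊤ : ℕ∞) G) (hΦ : ∀ t, Φ t =ᵐ[volume] fun x => G (t, x))
    (hsupp : ∀ t ∈ Set.Icc (-1 : ℝ) 1, ∀ x ∉ K, G (t, x) = 0) :
    ∃ Φ' : StateSpace n, IsTestVector Φ' ∧ HasDerivAt Φ Φ' 0 := by
  set g : ℝ × Config n → ℂ := fun p => fderiv ℝ G p (1, 0) with hg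
  have hgd : ContDiff ℝ (⊤ : ℕ∞) g := (hG.fderiv_right (m := (⊤ : ℕ∞)) (by simp)).clm_apply contDiff_const
  set k : ℝ × Config n → ℂ := fun p => fderiv ℝ g p (1, 0) with hk
  have hkc : Continuous k := ((hgd.fderiv_right (m := (⊤ : ℕ∞)) (by simp)).clm_apply contDiff_const).continuous
  have line : ∀ (F : ℝ × Config n → ℂ), ContDiff ℝ (⊤ : ℕ∞) F → ∀ t x,
      HasDerivAt (fun t => F (t, x)) (fderiv ℝ F (t, x) (1, 0)) t := fun F hF t x => by
    have h1 := (hF.differentiable (by simp) (t, x)).hasFDerivAt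
    exact h1.comp_hasDerivAt t ((hasDerivAt_id t).prodMk (hasDerivAt_const t x))
  have hg0 : ∀ x ∉ K, g (0, x) = 0 := fun x hx => by
    have h1 := line G hG 0 x
    have h2 : (fun t => G (t, x)) =ᶠ[𝓝 0] fun _ => 0 := by
      filter_upwards [Icc_mem_nhds (by norm_num : (-1 : ℝ) < 0) (by norm_num : (0 : ℝ) < 1)]
        with t ht using hsupp t ht x hx
    exact h1.unique ((hasDerivAt_const (0 : ℝ) (0 : ℂ)).congr_of_eventuallyEq h2)
  have hgs : HasCompactSupport fun x => g (0, x) := HasCompactSupport.intro hK hg0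
  have hgs' : ContDiff ℝ (⊤ : ℕ∞) fun x => g (0, x) := hgd.comp (by fun_prop)
  have hmem : MemLp (fun x => g (0, x)) 2 (volume : Measure (Config n)) :=
    hgs'.continuous.memLp_of_hasCompactSupport hgs
  obtain ⟨C, hC⟩ := (isCompact_Icc.prod hK : IsCompact (Set.Icc (-1 : ℝ) 1 ×ˢ K)).exists_bound_of_continuousOn
    hkc.continuousOn
  -- The candidate derivative is the pointwise one. `C` bounds the second time derivative on the
  -- compact set, so the first order Taylor remainder is at most `max C 0 * t ^ 2` on `K` and zero
  -- off `K`; hence it is `O(t²)` in `L²`.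
  refine ⟨hmem.toLp _, ⟨_, hmem.coeFn_toLp, hgs, hgs'⟩, ?_⟩
  have hC0 : 0 ≤ max C 0 := le_max_right _ _
  have bound : ∀ t ∈ Set.Icc (-1 : ℝ) 1, ∀ x, ‖G (t, x) - G (0, x) - t • g (0, x)‖ ≤
      max C 0 * t ^ 2 * ‖K.indicator (fun _ => (1 : ℂ)) x‖ := by
    intro t ht x
    by_cases hx : x ∈ K
    · rw [Set.indicator_of_mem hx, norm_one, mul_one]
      have hsub : Set.uIcc 0 t ⊆ Set.Icc (-1) 1 :=
        Set.uIcc_subset_Icc (by norm_num) ht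
      have h1 : ∀ s ∈ Set.uIcc 0 t, ‖g (s, x) - g (0, x)‖ ≤ max C 0 * |t| := fun s hs => by
        have h2 := (convex_uIcc 0 t).norm_image_sub_le_of_norm_hasDerivWithin_le
          (f := fun s => g (s, x)) (f' := fun s => k (s, x)) (C := max C 0)
          (fun r _ => (line g hgd r x).hasDerivWithinAt)
          (fun r hr => (hC (r, x) ⟨hsub hr, hx⟩).trans (le_max_left _ _)) Set.left_mem_uIcc hs
        refine h2.trans ?_
        have h3 : ‖s - 0‖ ≤ |t| := by
          rw [sub_zero, Real.norm_eq_abs]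
          rcases Set.mem_uIcc.1 hs with h | h
          · rw [abs_of_nonneg h.1]
            exact h.2.trans (le_abs_self t)
          · rw [abs_of_nonpos h.2, abs_of_nonpos (h.1.trans h.2)]
            linarith
        gcongr
      have h4 := (convex_uIcc 0 t).norm_image_sub_le_of_norm_hasDerivWithin_le
        (f := fun s => G (s, x) - s • g (0, x)) (f' := fun s => g (s, x) - (1 : ℝ) • g (0, x))
        (C := max C 0 * |t|)
        (fun r _ => ((line G hG r x).sub ((hasDerivAt_id r).smul_const _)).hasDerivWithinAt)
        (fun r hr => by rw [one_smul]; exact h1 r hr) Set.left_mem_uIcc Set.right_mem_uIcc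
      rw [zero_smul, sub_zero, sub_zero, Real.norm_eq_abs, mul_assoc, ← sq, sq_abs] at h4
      rw [sub_right_comm]
      exact h4
    · rw [hsupp t ht x hx, hsupp 0 (by norm_num) x hx, hg0 x hx]
      simp only [smul_zero, sub_zero, norm_zero]
      positivity
  have hKm : MeasurableSet K := hK.measurableSet
  have hKf : (volume : Measure (Config n)) K ≠ ∞ := hK.measure_lt_top.ne
  have key : ∀ t ∈ Set.Icc (-1 : ℝ) 1, ‖Φ t - Φ 0 - t • hmem.toLp _‖ ≤
      max C 0 * t ^ 2 * ‖indicatorConstLp 2 hKm hKf (1 : ℂ)‖ := by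
    intro t ht
    refine Lp.norm_le_mul_norm_of_ae_le_mul ?_
    filter_upwards [Lp.coeFn_sub (Φ t - Φ 0) (t • hmem.toLp _), Lp.coeFn_sub (Φ t) (Φ 0),
      Lp.coeFn_smul t (hmem.toLp _), hΦ t, hΦ 0, hmem.coeFn_toLp,
      indicatorConstLp_coeFn (p := 2) (hs := hKm) (hμs := hKf) (c := (1 : ℂ))]
      with x h1 h2 h3 h4 h5 h6 h7
    rw [h1, Pi.sub_apply, h2, h3, Pi.sub_apply, Pi.smul_apply, h4, h5, h6, h7]
    exact bound t ht x
  rw [hasDerivAt_iff_isLittleO_nhds_zero]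
  have hO : (fun h : ℝ => Φ (0 + h) - Φ 0 - h • hmem.toLp _) =O[𝓝 0] fun h : ℝ => h ^ 2 := by
    refine Asymptotics.IsBigO.of_bound (max C 0 * ‖indicatorConstLp 2 hKm hKf (1 : ℂ)‖) ?_
    filter_upwards [Icc_mem_nhds (by norm_num : (-1 : ℝ) < 0) (by norm_num : (0 : ℝ) < 1)]
      with t ht
    rw [zero_add, Real.norm_of_nonneg (sq_nonneg t)]
    linarith [key t ht]
  exact hO.trans_isLittleO (Asymptotics.isLittleO_pow_id one_lt_two)

/-- That the derivative is again a test vector makes the class stable under every `opR j`, hence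
contained in all the domains of the squares. -/
lemma IsTestVector.hasDerivAt_weyl {φ : StateSpace n} (h : IsTestVector φ) (z : PhaseSpace n) :
    ∃ φ' : StateSpace n, IsTestVector φ' ∧
      HasDerivAt (fun t : ℝ => QuantumDiffusion.weyl (t • z) φ) φ' 0 := by
  obtain ⟨f, hf, hc, hd⟩ := h
  -- One compact set that contains the supports of all translates with `|t| ≤ 1`.
  have hK : IsCompact ((fun p : ℝ × Config n => p.2 - p.1 • pos z) ''
      (Set.Icc (-1 : ℝ) 1 ×ˢ tsupport f)) :=
    (isCompact_Icc.prod hc).image (by fun_prop)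
  refine hasDerivAt_of_contDiff (G := fun p => weylPhase (p.1 • z) p.2 * f (p.2 + p.1 • pos z)) hK
    ?_ (fun t => weyl_coeFn_of_ae_eq (t • z) hf) ?_
  · refine ContDiff.mul ?_ (hd.comp (by fun_prop))
    unfold weylPhase
    simp only [mom_smul, pos_smul]
    have h : ContDiff ℝ (⊤ : ℕ∞) fun p : ℝ × Config n =>
        ⟪p.1 • mom z, p.2⟫_ℝ + ⟪p.1 • mom z, p.1 • pos z⟫_ℝ / 2 := by
      refine ContDiff.add (ContDiff.inner ℝ ?_ ?_) ((ContDiff.inner ℝ ?_ ?_).div_const _) <;>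
        fun_prop
    exact (contDiff_const.mul (Complex.ofRealCLM.contDiff.comp h)).cexp
  · intro t ht x hx
    have : f (x + t • pos z) = 0 := by
      by_contra hne
      exact hx ⟨(t, x + t • pos z), ⟨ht, subset_tsupport f hne⟩, by simp⟩
    simp only [this, mul_zero]

lemma IsTestVector.smul {φ : StateSpace n} (h : IsTestVector φ) (c : ℂ) : IsTestVector (c • φ) := by
  obtain ⟨f, hf, hc, hd⟩ := h
  refine ⟨fun x => c * f x, ?_, hc.mul_left, contDiff_const.mul hd⟩
  filter_upwards [Lp.coeFn_smul c φ, hf] with x h1 h2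
  rw [h1, Pi.smul_apply, h2, smul_eq_mul]

lemma IsTestVector.inDomR {φ : StateSpace n} (h : IsTestVector φ) (j : Fin n ⊕ Fin n) :
    InDomR j φ := by
  obtain ⟨φ', -, h2⟩ := h.hasDerivAt_weyl (direction j)
  exact h2.differentiableAt

lemma IsTestVector.opR {φ : StateSpace n} (h : IsTestVector φ) (j : Fin n ⊕ Fin n) :
    IsTestVector (opR j φ) := by
  obtain ⟨φ', h1, h2⟩ := h.hasDerivAt_weyl (direction j)
  rw [QuantumDiffusion.opR, h2.deriv]
  exact h1.smul _

lemma IsTestVector.inDomRSq {φ : StateSpace n} (h : IsTestVector φ) : InDomRSq φ :=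
  fun j => ⟨h.inDomR j, (h.opR j).inDomR j⟩

/-- The group law along a line transports differentiability from time zero to every `s`. -/
lemma InDomR.hasDerivAt_weyl {φ : StateSpace n} {j : Fin n ⊕ Fin n} (h : InDomR j φ) (s : ℝ) :
    HasDerivAt (fun s : ℝ => weyl (s • direction j) φ)
      (weyl (s • direction j) (Complex.I • opR j φ)) s := by
  have h0 : Complex.I • opR j φ = deriv (fun t : ℝ => weyl (t • direction j) φ) 0 := by
    rw [opR, smul_smul]
    simp
  have h1 : HasDerivAt (fun t : ℝ => weyl (t • direction j) φ) (Complex.I • opR j φ) (s - s) := by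
    rw [sub_self, h0]
    exact DifferentiableAt.hasDerivAt h
  have h2 := ((weyl (s • direction j)).restrictScalars ℝ).hasFDerivAt.comp_hasDerivAt s
    (HasDerivAt.comp_sub_const s s h1)
  refine h2.congr_of_eventuallyEq (Eventually.of_forall fun r => ?_)
  change _ = weyl (s • direction j) (weyl ((r - s) • direction j) φ)
  rw [← weyl_smul_add, add_sub_cancel]

end Weyl

/-! ### Matrix elements of the Weyl operators -/

section MatrixElements

variable {n : ℕ}

lemma continuous_pos : Continuous (pos : PhaseSpace n → Config n) := by
  unfold pos
  fun_prop

lemma continuous_mom : Continuous (mom : PhaseSpace n → Config n) := by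
  unfold mom
  fun_prop

lemma inner_weyl_eq_integral {φ ψ : StateSpace n} {f g : Config n → ℂ} (hφ : φ =ᵐ[volume] f)
    (hψ : ψ =ᵐ[volume] g) (w : PhaseSpace n) :
    ⟪ψ, weyl w φ⟫_ℂ = ∫ x, starRingEnd ℂ (g x) * (weylPhase w x * f (x + pos w)) := by
  rw [L2.inner_def]
  refine integral_congr_ae ?_
  filter_upwards [hψ, weyl_coeFn_of_ae_eq w hφ] with x h1 h2
  rw [h1, h2, RCLike.inner_apply, mul_comm]

lemma IsTestVector.continuous_inner_weyl {φ ψ : StateSpace n} (hφ : IsTestVector φ)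
    (hψ : IsTestVector ψ) : Continuous fun w => ⟪ψ, QuantumDiffusion.weyl w φ⟫_ℂ := by
  obtain ⟨f, hf, hfc, hfd⟩ := hφ
  obtain ⟨g, hg, hgc, hgd⟩ := hψ
  simp_rw [inner_weyl_eq_integral hf hg]
  obtain ⟨C, hC⟩ := hfd.continuous.bounded_above_of_compact_support hfc
  have hgi : Integrable g := hgd.continuous.integrable_of_hasCompactSupport hgc
  refine continuous_of_dominated (bound := fun x => ‖g x‖ * C) (fun w => ?_) (fun w => ?_)
    (hgi.norm.mul_const C) (Eventually.of_forall fun x => ?_)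
  · refine Continuous.aestronglyMeasurable ?_
    have := hfd.continuous
    have := hgd.continuous
    have := continuous_weylPhase w
    fun_prop
  · refine Eventually.of_forall fun x => ?_
    rw [norm_mul, norm_mul, norm_weylPhase, one_mul, RCLike.norm_conj]
    exact mul_le_mul_of_nonneg_left (hC _) (norm_nonneg _)
  · refine continuous_const.mul (Continuous.mul ?_ (hfd.continuous.comp
      (continuous_const.add continuous_pos)))
    unfold weylPhase
    have := continuous_pos (n := n)
    have := continuous_mom (n := n)
    fun_prop

/-- Weyl operators are isometric, so continuity of `⟨φ, V(w)φ⟩` already gives strong continuity. -/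
lemma IsTestVector.tendsto_norm_weyl_sub {φ : StateSpace n} (hφ : IsTestVector φ) :
    Tendsto (fun w => ‖QuantumDiffusion.weyl w φ - φ‖) (𝓝 0) (𝓝 0) := by
  have h1 : ∀ w, ‖QuantumDiffusion.weyl w φ - φ‖ ^ 2 =
      2 * ‖φ‖ ^ 2 - 2 * (⟪φ, QuantumDiffusion.weyl w φ⟫_ℂ).re := fun w => by
    have := norm_sub_sq (𝕜 := ℂ) φ (QuantumDiffusion.weyl w φ)
    rw [norm_sub_rev, this, norm_weyl]
    change ‖φ‖ ^ 2 - 2 * (⟪φ, QuantumDiffusion.weyl w φ⟫_ℂ).re + ‖φ‖ ^ 2 = _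
    ring
  have h2 : Continuous fun w => ‖QuantumDiffusion.weyl w φ - φ‖ := by
    have : (fun w => ‖QuantumDiffusion.weyl w φ - φ‖) = fun w =>
        Real.sqrt (2 * ‖φ‖ ^ 2 - 2 * (⟪φ, QuantumDiffusion.weyl w φ⟫_ℂ).re) := by
      funext w
      rw [← h1, Real.sqrt_sq (norm_nonneg _)]
    rw [this]
    have h := Complex.continuous_re.comp (hφ.continuous_inner_weyl hφ)
    exact (continuous_const.sub (continuous_const.mul h)).sqrt
  have h3 := h2.tendsto 0
  rwa [weyl_zero, sub_self, norm_zero] at h3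

/-- Phase space as the product of position space and momentum space. -/
def phaseEquiv (n : ℕ) : PhaseSpace n ≃ᵐ Config n × Config n :=
  (MeasurableEquiv.toLp 2 (Fin n ⊕ Fin n → ℝ)).symm.trans <|
    (MeasurableEquiv.sumPiEquivProdPi fun _ => ℝ).trans <|
      MeasurableEquiv.prodCongr (MeasurableEquiv.toLp 2 (Fin n → ℝ))
        (MeasurableEquiv.toLp 2 (Fin n → ℝ))

lemma measurePreserving_phaseEquiv : MeasurePreserving (phaseEquiv n) volume volume := by
  refine (EuclideanSpace.volume_preserving_symm_measurableEquiv_toLp _).trans ?_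
  refine (volume_measurePreserving_sumPiEquivProdPi _).trans ?_
  exact MeasurePreserving.prod (PiLp.volume_preserving_toLp _) (PiLp.volume_preserving_toLp _)

/-- Rescaling the momentum by `(2π)⁻¹` matches the convention `e^{-2πi⟨x, ξ⟩}` for the Fourier
transform; the remaining constant phase has modulus one. -/
lemma norm_integral_weylPhase_mul (w : PhaseSpace n) (h : Config n → ℂ) :
    ‖∫ x, weylPhase w x * h x‖ = ‖FourierTransform.fourier h ((2 * Real.pi)⁻¹ • mom w)‖ := by
  have e : ∀ x, weylPhase w x * h x = Complex.exp (-Complex.I * ((⟪mom w, pos w⟫_ℝ / 2 : ℝ) : ℂ)) *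
      (Complex.exp (((-2 * Real.pi * ⟪x, (2 * Real.pi)⁻¹ • mom w⟫_ℝ : ℝ) : ℂ) * Complex.I) •
        h x) := fun x => by
    rw [smul_eq_mul, ← mul_assoc, ← Complex.exp_add]
    unfold weylPhase
    congr 2
    rw [real_inner_smul_right, real_inner_comm (mom w) x]
    have : -2 * Real.pi * ((2 * Real.pi)⁻¹ * ⟪mom w, x⟫_ℝ) = -⟪mom w, x⟫_ℝ := by
      field_simp
    rw [this]
    push_cast
    ring
  simp_rw [e]
  rw [integral_const_mul, norm_mul, Complex.norm_exp, Real.fourier_eq']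
  simp

lemma plancherel_scaled {h : Config n → ℂ} (hc : HasCompactSupport h) (hd : ContDiff ℝ (⊤ : ℕ∞) h) :
    Integrable (fun p : Config n => ‖FourierTransform.fourier h ((2 * Real.pi)⁻¹ • p)‖ ^ 2) ∧
    ∫ p : Config n, ‖FourierTransform.fourier h ((2 * Real.pi)⁻¹ • p)‖ ^ 2 =
      (2 * Real.pi) ^ n * ∫ x, ‖h x‖ ^ 2 := by
  set S := hc.toSchwartzMap hd with hS
  have hSh : ∀ x, S x = h x := fun x => rfl
  have e : FourierTransform.fourier h = ⇑(FourierTransform.fourier S) := by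
    rw [SchwartzMap.fourier_coe]
    rfl
  have hI : Integrable fun p : Config n => ‖FourierTransform.fourier h p‖ ^ 2 := by
    rw [e]
    have := (FourierTransform.fourier S).memLp 2 (volume : Measure (Config n))
    exact this.integrable_norm_pow (by simp)
  have hpi : (2 * Real.pi)⁻¹ ≠ 0 := by positivity
  refine ⟨hI.comp_smul hpi, ?_⟩
  have h1 := Measure.integral_comp_smul (volume : Measure (Config n))
    (fun p => ‖FourierTransform.fourier h p‖ ^ 2) (2 * Real.pi)⁻¹
  rw [h1, finrank_euclideanSpace, Fintype.card_fin, e, SchwartzMap.integral_norm_sq_fourier,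
    smul_eq_mul, inv_pow, inv_inv, abs_of_pos (by positivity)]
  rfl

lemma norm_sq_eq_integral {φ : StateSpace n} {f : Config n → ℂ} (h : φ =ᵐ[volume] f) :
    ‖φ‖ ^ 2 = ∫ x, ‖f x‖ ^ 2 := by
  have h1 : ((‖φ‖ ^ 2 : ℝ) : ℂ) = ∫ x, ((‖f x‖ ^ 2 : ℝ) : ℂ) := by
    have := inner_self_eq_norm_sq_to_K (𝕜 := ℂ) φ
    push_cast
    refine this.symm.trans ?_
    rw [L2.inner_def]
    refine integral_congr_ae ?_
    filter_upwards [h] with x hx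
    rw [hx]
    exact inner_self_eq_norm_sq_to_K (𝕜 := ℂ) (f x)
  rw [integral_complex_ofReal] at h1
  exact_mod_cast h1

/-- Square integrability of the matrix elements of the Weyl operators. -/
theorem IsTestVector.integral_norm_sq_inner_weyl {φ ψ : StateSpace n} (hφ : IsTestVector φ)
    (hψ : IsTestVector ψ) :
    Integrable (fun w => ‖⟪ψ, QuantumDiffusion.weyl w φ⟫_ℂ‖ ^ 2) ∧
    ∫ w, ‖⟪ψ, QuantumDiffusion.weyl w φ⟫_ℂ‖ ^ 2 = (2 * Real.pi) ^ n * (‖φ‖ ^ 2 * ‖ψ‖ ^ 2) := by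
  have hcont := hφ.continuous_inner_weyl hψ
  obtain ⟨f, hf, hfc, hfd⟩ := hφ
  obtain ⟨g, hg, hgc, hgd⟩ := hψ
  set F : Config n × Config n → ℝ := fun r =>
    ‖⟪ψ, QuantumDiffusion.weyl ((phaseEquiv n).symm r) φ⟫_ℂ‖ ^ 2 with hF
  have hFe : (fun w => ‖⟪ψ, QuantumDiffusion.weyl w φ⟫_ℂ‖ ^ 2) = F ∘ phaseEquiv n := by
    funext w
    simp [hF]
  have hFm : Measurable F :=
    (hcont.norm.pow 2).measurable.comp (phaseEquiv n).symm.measurable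
  -- At fixed position `q`, the matrix element as a function of `p` is, up to a phase, the rescaled
  -- Fourier transform of `h q`. Plancherel integrates out `p`, and Fubini with translation
  -- invariance integrates out `q`.
  set h : Config n → Config n → ℂ := fun q x => starRingEnd ℂ (g x) * f (x + q) with hh
  have hhc : ∀ q, HasCompactSupport (h q) := fun q =>
    (hgc.comp_left (g := starRingEnd ℂ) (map_zero _)).mul_right
  have hhd : ∀ q, ContDiff ℝ (⊤ : ℕ∞) (h q) := fun q =>
    (Complex.conjCLE.contDiff.comp hgd).mul (hfd.comp (by fun_prop))
  have hFq : ∀ q p, F (q, p) = ‖FourierTransform.fourier (h q) ((2 * Real.pi)⁻¹ • p)‖ ^ 2 := by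
    intro q p
    obtain ⟨w, hw⟩ := (phaseEquiv n).surjective (q, p)
    have hq : pos w = q := congrArg Prod.fst hw
    have hp : mom w = p := congrArg Prod.snd hw
    simp only [hF]
    rw [← hw, MeasurableEquiv.symm_apply_apply, inner_weyl_eq_integral hf hg, ← hp,
      ← norm_integral_weylPhase_mul, hh]
    congr 2
    refine integral_congr_ae (Eventually.of_forall fun x => ?_)
    simp only [hq]
    ring
  have hslice : ∀ q, Integrable (fun p => F (q, p)) ∧
      ∫ p, F (q, p) = (2 * Real.pi) ^ n * ∫ x, ‖g x‖ ^ 2 * ‖f (x + q)‖ ^ 2 := fun q => by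
    simp_rw [hFq]
    have := plancherel_scaled (hhc q) (hhd q)
    refine ⟨this.1, this.2.trans ?_⟩
    congr 1
    refine integral_congr_ae (Eventually.of_forall fun x => ?_)
    simp only [hh, norm_mul, RCLike.norm_conj, mul_pow]
  have hfi : Integrable fun x => ‖f x‖ ^ 2 :=
    (hfd.continuous.memLp_of_hasCompactSupport (p := 2) hfc).integrable_norm_pow (by simp)
  have hgi : Integrable fun x => ‖g x‖ ^ 2 :=
    (hgd.continuous.memLp_of_hasCompactSupport (p := 2) hgc).integrable_norm_pow (by simp)
  -- The shear `(x, q) ↦ (x, x + q)` preserves the measure and turns this into a product of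
  -- integrable functions.
  have hprod : Integrable (fun r : Config n × Config n => ‖g r.1‖ ^ 2 * ‖f (r.1 + r.2)‖ ^ 2)
      (volume.prod volume) :=
    (measurePreserving_prod_add (volume : Measure (Config n))
      (volume : Measure (Config n))).integrable_comp_of_integrable (hgi.mul_prod hfi)
  have hswap := hprod.swap
  have hFi : Integrable F (volume.prod volume) := by
    rw [integrable_prod_iff hFm.aestronglyMeasurable]
    refine ⟨Eventually.of_forall fun q => (hslice q).1, ?_⟩
    have e : (fun q => ∫ p, ‖F (q, p)‖) =
        fun q => (2 * Real.pi) ^ n * ∫ x, ‖g x‖ ^ 2 * ‖f (x + q)‖ ^ 2 := by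
      funext q
      rw [← (hslice q).2]
      refine integral_congr_ae (Eventually.of_forall fun p => ?_)
      exact Real.norm_of_nonneg (by simp only [hF]; positivity)
    rw [e]
    exact (hswap.integral_prod_left).const_mul _
  constructor
  · rw [hFe]
    exact measurePreserving_phaseEquiv.integrable_comp_of_integrable hFi
  · rw [hFe]
    have e1 : ∫ w, (F ∘ phaseEquiv n) w = ∫ r, F r :=
      measurePreserving_phaseEquiv.integral_comp' F
    rw [e1, show (∫ r, F r) = ∫ r, F r ∂(volume.prod volume) from rfl, integral_prod F hFi]
    simp_rw [fun q => (hslice q).2]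
    rw [integral_const_mul]
    congr 1
    rw [← integral_prod (fun r : Config n × Config n => ‖g r.2‖ ^ 2 * ‖f (r.2 + r.1)‖ ^ 2) hswap,
      ← integral_prod_swap]
    change ∫ r : Config n × Config n, ‖g r.1‖ ^ 2 * ‖f (r.1 + r.2)‖ ^ 2 ∂(volume.prod volume) = _
    rw [integral_prod _ hprod]
    simp only
    simp_rw [integral_const_mul, integral_add_left_eq_self (fun x => ‖f x‖ ^ 2)]
    rw [integral_mul_const, ← norm_sq_eq_integral hf, ← norm_sq_eq_integral hg, mul_comm]

end MatrixElements

/-! ### The heat equation on phase space and the rank one bound -/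

section Ultracontractivity

variable {n : ℕ} {Λ : ℝ → (StateSpace n →L[ℂ] StateSpace n) → (StateSpace n →L[ℂ] StateSpace n)}
  {t : ℝ}

lemma norm_direction (j : Fin n ⊕ Fin n) : ‖direction j‖ = 1 := by
  cases j <;> simp [direction]

lemma sum_inner_direction_sq (x : PhaseSpace n) : ∑ j, ⟪x, direction j⟫_ℝ ^ 2 = ‖x‖ ^ 2 := by
  rw [EuclideanSpace.real_norm_sq_eq, Fintype.sum_sum_type, Fintype.sum_sum_type, add_comm]
  congr 1 <;>
  · refine Finset.sum_congr rfl fun j _ => ?_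
    simp [direction, EuclideanSpace.inner_single_right]

lemma evolvedForm_weyl_weyl (hΛ : IsQuantumDynamicalSemigroup Λ) (ht : 0 ≤ t)
    (ψ φ : StateSpace n) (z w : PhaseSpace n) :
    evolvedForm Λ t ψ (weyl z (weyl w φ)) (weyl z (weyl w φ)) =
      evolvedForm Λ t ψ (weyl (z + w) φ) (weyl (z + w) φ) := by
  rw [weyl_weyl, hΛ.evolvedForm_self_smul ht ψ _ (norm_weylCocycle z w)]

/-- Up to an invisible phase, `V(w + sζⱼ)φ` is `exp(isR_j)χ` with `χ = V(w)φ`. The product rule,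
applied twice to the bounded real bilinear form, gives the expectation of `-[R_j, [R_j, |χ⟩⟨χ|]]`; a
quarter of the sum over `j` is the generator. -/
lemma IsQuantumDiffusionSemigroup.isHeatSolutionAt (hΛ : IsQuantumDiffusionSemigroup Λ)
    (ht : 0 < t) (ψ : StateSpace n) {φ : StateSpace n} (hφ : IsTestVector φ) (w : PhaseSpace n) :
    IsHeatSolutionAt direction (fun t w => (evolvedForm Λ t ψ (weyl w φ) (weyl w φ)).re) t w := by
  have hΛ' := hΛ.toIsQuantumDynamicalSemigroup
  set χ := weyl w φ with hχ
  have hχt : IsTestVector χ := hφ.weyl w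
  obtain ⟨B, hB⟩ := hΛ'.exists_realForm ht.le ψ
  refine ⟨fun j => -((evolvedForm Λ t ψ (opR j (opR j χ)) χ).re
        - 2 * (evolvedForm Λ t ψ (opR j χ) (opR j χ)).re
        + (evolvedForm Λ t ψ χ (opR j (opR j χ))).re), fun j => ?_, ?_⟩
  · have h1 := (hχt.inDomR j).hasDerivAt_weyl
    have h2 : ∀ s : ℝ, HasDerivAt (fun s : ℝ => weyl (s • direction j) (Complex.I • opR j χ))
        (weyl (s • direction j) (-opR j (opR j χ))) s := fun s => by
      have h := (((hχt.opR j).inDomR j).hasDerivAt_weyl s).const_smul Complex.I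
      simp only [← _root_.map_smul, smul_smul, Complex.I_mul_I, neg_smul, one_smul] at h
      refine h.congr_of_eventuallyEq (Eventually.of_forall fun r => ?_)
      simp
    refine ⟨fun s => B (weyl (s • direction j) χ) (weyl (s • direction j) (Complex.I • opR j χ)) +
      B (weyl (s • direction j) (Complex.I • opR j χ)) (weyl (s • direction j) χ), fun s => ?_, ?_⟩
    · have h := B.hasDerivAt_of_bilinear (fun _ => h1 s) fun _ => h1 s
      refine h.congr_of_eventuallyEq (Eventually.of_forall fun r => ?_)
      simp only
      rw [hB, hχ, evolvedForm_weyl_weyl hΛ' ht.le, add_comm w]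
    · have h := (B.hasDerivAt_of_bilinear (fun _ => h1 0) fun _ => h2 0).add
        (B.hasDerivAt_of_bilinear (fun _ => h2 0) fun _ => h1 0)
      refine h.congr_deriv ?_
      simp only [zero_smul, weyl_zero, hB, ← neg_one_smul ℂ (opR j (opR j χ)),
        hΛ'.evolvedForm_smul_left ht.le, hΛ'.evolvedForm_smul_right ht.le]
      rw [← mul_assoc, Complex.conj_I, mul_neg, Complex.I_mul_I]
      simp
      ring
  · have h := hΛ.hasDerivWithinAt_re_evolvedForm ht ψ χ hχt.inDomRSq
    refine h.congr_deriv ?_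
    rw [Finset.sum_neg_distrib]
    ring

/-- A modulus of continuity in phase space, uniform in the base point `w` and in `t`. It serves both
joint continuity and the estimate of the initial value. -/
lemma abs_re_evolvedForm_weyl_sub_le (hΛ : IsQuantumDynamicalSemigroup Λ) (ht : 0 ≤ t)
    (ψ φ : StateSpace n) (w y : PhaseSpace n) :
    |(evolvedForm Λ t ψ (weyl (w + y) φ) (weyl (w + y) φ)).re -
      (evolvedForm Λ t ψ (weyl w φ) (weyl w φ)).re| ≤
      4 * ‖ψ‖ ^ 2 * ‖φ‖ * ‖weyl y φ - φ‖ := by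
  rw [← evolvedForm_weyl_weyl hΛ ht]
  refine (hΛ.abs_re_evolvedForm_self_sub_le ht ψ _ _).trans_eq ?_
  rw [← map_sub, norm_weyl, norm_weyl, norm_weyl, norm_weyl]
  ring

lemma continuousOn_re_evolvedForm_weyl (hΛ : IsQuantumDynamicalSemigroup Λ) (ψ : StateSpace n)
    {φ : StateSpace n} (hφ : IsTestVector φ) :
    ContinuousOn (fun p : ℝ × PhaseSpace n =>
      (evolvedForm Λ p.1 ψ (weyl p.2 φ) (weyl p.2 φ)).re) (Set.Ici 0 ×ˢ Set.univ) := by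
  rintro ⟨t₀, w₀⟩ ⟨ht₀, -⟩
  have h1 : Tendsto (fun p : ℝ × PhaseSpace n =>
      (evolvedForm Λ p.1 ψ (weyl w₀ φ) (weyl w₀ φ)).re)
      (𝓝[Set.Ici 0 ×ˢ Set.univ] (t₀, w₀)) (𝓝 (evolvedForm Λ t₀ ψ (weyl w₀ φ) (weyl w₀ φ)).re) := by
    refine (hΛ.continuousOn_re_evolvedForm ψ (weyl w₀ φ) t₀ ht₀).tendsto.comp ?_
    refine tendsto_nhdsWithin_iff.2 ⟨?_, ?_⟩
    · exact (continuous_fst.tendsto (t₀, w₀)).mono_left nhdsWithin_le_nhds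
    · filter_upwards [self_mem_nhdsWithin] with p hp using hp.1
  have h2 : Tendsto (fun p : ℝ × PhaseSpace n =>
      (evolvedForm Λ p.1 ψ (weyl p.2 φ) (weyl p.2 φ)).re -
      (evolvedForm Λ p.1 ψ (weyl w₀ φ) (weyl w₀ φ)).re)
      (𝓝[Set.Ici 0 ×ˢ Set.univ] (t₀, w₀)) (𝓝 0) := by
    have h3 : Tendsto (fun p : ℝ × PhaseSpace n => p.2 - w₀) (𝓝 (t₀, w₀)) (𝓝 0) := by
      have : Continuous fun p : ℝ × PhaseSpace n => p.2 - w₀ := by fun_prop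
      simpa using this.tendsto (t₀, w₀)
    have h4 := ((hφ.tendsto_norm_weyl_sub.comp h3).const_mul (4 * ‖ψ‖ ^ 2 * ‖φ‖)).mono_left
      (nhdsWithin_le_nhds (s := Set.Ici 0 ×ˢ Set.univ))
    rw [mul_zero] at h4
    refine squeeze_zero_norm' ?_ h4
    filter_upwards [self_mem_nhdsWithin] with p hp
    have h5 := abs_re_evolvedForm_weyl_sub_le hΛ hp.1 ψ φ w₀ (p.2 - w₀)
    rwa [add_sub_cancel] at h5
  have h6 := h2.add h1
  simp only [sub_add_cancel, zero_add] at h6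
  exact h6

lemma re_evolvedForm_zero (hΛ : IsQuantumDynamicalSemigroup Λ) (ψ φ : StateSpace n) :
    (evolvedForm Λ 0 ψ φ φ).re = ‖⟪ψ, φ⟫_ℂ‖ ^ 2 := by
  rw [evolvedForm, hΛ.map_zero_time _ (isTraceClass_rankOne φ φ), re_inner_rankOne_self]

lemma IsQuantumDiffusionSemigroup.re_evolvedForm_le_of_isTestVector
    (hΛ : IsQuantumDiffusionSemigroup Λ) (ht : 0 < t) {ψ φ : StateSpace n} (hψ : IsTestVector ψ)
    (hφ : IsTestVector φ) :
    (evolvedForm Λ t ψ φ φ).re ≤ (2 / t) ^ n * (‖φ‖ ^ 2 * ‖ψ‖ ^ 2) := by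
  have hΛ' := hΛ.toIsQuantumDynamicalSemigroup
  have hM := hφ.integral_norm_sq_inner_weyl hψ
  have h0 : ∀ w, (evolvedForm Λ 0 ψ (weyl w φ) (weyl w φ)).re = ‖⟪ψ, weyl w φ⟫_ℂ‖ ^ 2 :=
    fun w => re_evolvedForm_zero hΛ' ψ _
  have key := le_heatKernel_mul_integral (n := n) (ζ := direction (n := n))
    (u := fun t w => (evolvedForm Λ t ψ (weyl w φ) (weyl w φ)).re) (B := ‖φ‖ ^ 2 * ‖ψ‖ ^ 2)
    (by simp [two_mul]) (by simp [two_mul]) norm_direction sum_inner_direction_sq ht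
    ((continuousOn_re_evolvedForm_weyl hΛ' ψ hφ).mono
      (Set.prod_mono Set.Icc_subset_Ici_self le_rfl))
    (fun s hs w => hΛ.isHeatSolutionAt hs.1 ψ hφ w)
    (fun s hs w => by
      have := hΛ'.re_evolvedForm_self_le hs.1 ψ (weyl w φ)
      rwa [norm_weyl] at this)
    (fun w => hΛ'.re_evolvedForm_self_nonneg le_rfl ψ _)
    (by simp only [h0]; exact hM.1) ?_ 0
  -- Evaluate at `w = 0`, where `V(0) = 1`; the constant is `(πt)⁻ⁿ (2π)ⁿ = (2/t)ⁿ`.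
  · simp only [h0, hM.2, weyl_zero] at key
    refine key.trans_eq ?_
    rw [← mul_assoc, ← inv_pow, ← mul_pow]
    congr 2
    have := Real.pi_pos
    field_simp
  · intro ε hε
    set A := 4 * ‖ψ‖ ^ 2 * ‖φ‖ with hA
    have hlim := hφ.tendsto_norm_weyl_sub.const_mul A
    rw [mul_zero] at hlim
    obtain ⟨r, hr, H⟩ := Metric.eventually_nhds_iff.1 (hlim.eventually_lt_const hε)
    -- For `‖y‖ < r` strong continuity gives `ε`. For `‖y‖ ≥ r` the trivial bound `2‖φ‖` is
    -- dominated by the quadratic term, which fixes the constant.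
    refine ⟨A * (2 * ‖φ‖) / r ^ 2, by positivity, fun w y => ?_⟩
    have h1 := abs_re_evolvedForm_weyl_sub_le hΛ' le_rfl ψ φ w (-y)
    rw [← sub_eq_add_neg] at h1
    refine h1.trans ?_
    rcases lt_or_ge ‖y‖ r with h | h
    · have h2 := (H (y := -y) (by simpa using h)).le
      have : 0 ≤ A * (2 * ‖φ‖) / r ^ 2 * ‖y‖ ^ 2 := by positivity
      linarith
    · have h2 : ‖weyl (-y) φ - φ‖ ≤ 2 * ‖φ‖ := by
        have := norm_sub_le (weyl (-y) φ) φ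
        rw [norm_weyl] at this
        linarith
      have h3 : A * (2 * ‖φ‖) ≤ A * (2 * ‖φ‖) / r ^ 2 * ‖y‖ ^ 2 := by
        rw [div_mul_eq_mul_div, le_div_iff₀ (by positivity)]
        gcongr
      calc _ ≤ A * (2 * ‖φ‖) := by gcongr
        _ ≤ _ := by linarith

/-- Both sides are continuous in each vector separately, so density is used twice: for `φ` with a
test vector `ψ`, then for `ψ`. -/
lemma IsQuantumDiffusionSemigroup.re_evolvedForm_le (hΛ : IsQuantumDiffusionSemigroup Λ)
    (ht : 0 < t) (ψ φ : StateSpace n) :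
    (evolvedForm Λ t ψ φ φ).re ≤ (2 / t) ^ n * (‖φ‖ ^ 2 * ‖ψ‖ ^ 2) := by
  have hΛ' := hΛ.toIsQuantumDynamicalSemigroup
  have h1 : ∀ ψ, IsTestVector ψ →
      (evolvedForm Λ t ψ φ φ).re ≤ (2 / t) ^ n * (‖φ‖ ^ 2 * ‖ψ‖ ^ 2) := by
    intro ψ hψ
    obtain ⟨B, hB⟩ := hΛ'.exists_realForm ht.le ψ
    refine dense_isTestVector.induction (P := fun φ =>
      (evolvedForm Λ t ψ φ φ).re ≤ (2 / t) ^ n * (‖φ‖ ^ 2 * ‖ψ‖ ^ 2))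
      (fun φ hφ => hΛ.re_evolvedForm_le_of_isTestVector ht hψ hφ) ?_ φ
    simp_rw [← hB]
    exact isClosed_le (by fun_prop) (by fun_prop)
  refine dense_isTestVector.induction (P := fun ψ =>
    (evolvedForm Λ t ψ φ φ).re ≤ (2 / t) ^ n * (‖φ‖ ^ 2 * ‖ψ‖ ^ 2)) h1 ?_ ψ
  unfold evolvedForm
  refine isClosed_le (Complex.continuous_re.comp ?_) (by fun_prop)
  fun_prop

end Ultracontractivity

/-! ### Norm, Hilbert–Schmidt norm and entropy of positive operators -/

section PositiveOperators

variable {E : Type*} [NormedAddCommGroup E] [InnerProductSpace ℂ E] [CompleteSpace E]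

lemma isPositive_of_isSelfAdjoint {A : E →L[ℂ] E} (h : IsSelfAdjoint A)
    (h2 : ∀ x, 0 ≤ (⟪x, A x⟫_ℂ).re) : A.IsPositive := by
  rw [isPositive_def']
  refine ⟨h, fun x => ?_⟩
  rw [reApplyInnerSelf_apply, ← inner_conj_symm, RCLike.conj_re]
  exact h2 x

/-- Bessel's inequality for `S x`. The finite sums approximate `S²` from below by finite rank
operators. -/
lemma isPositive_mul_self_sub_sum {S : E →L[ℂ] E} (hS : IsSelfAdjoint S)
    (s : Finset (basisIndex E)) :
    (S * S - ∑ i ∈ s, InnerProductSpace.rankOne ℂ (S (onb E i)) (S (onb E i))).IsPositive := by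
  refine isPositive_of_isSelfAdjoint ?_ fun x => ?_
  · refine IsSelfAdjoint.sub ?_ (isSelfAdjoint_sum _ fun i _ =>
      (InnerProductSpace.isPositive_rankOne_self _).isSelfAdjoint)
    rw [IsSelfAdjoint, star_mul, hS.star_eq]
  · rw [sub_apply, inner_sub_right, Complex.sub_re, re_inner_mul_self hS, sum_apply, inner_sum,
      Complex.re_sum, sub_nonneg]
    have h := sum_le_hasSum s (fun i _ => by positivity) (hasSum_norm_inner_onb_sq (S x))
    refine le_trans (le_of_eq (Finset.sum_congr rfl fun i _ => ?_)) h
    rw [re_inner_rankOne_self, ← ContinuousLinearMap.adjoint_inner_left, hS.adjoint_eq,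
      norm_inner_symm]

lemma hasSum_norm_sq_sqrt {S : E →L[ℂ] E} (hS : IsSelfAdjoint S) (h : posTrace (S * S) = 1) :
    HasSum (fun i => ‖S (onb E i)‖ ^ 2) 1 := by
  unfold posTrace at h
  simp_rw [re_inner_mul_self hS] at h
  have h1 := ENNReal.hasSum_toReal (f := fun i => ENNReal.ofReal (‖S (onb E i)‖ ^ 2))
    (by rw [h]; exact ENNReal.one_ne_top)
  simp only [ENNReal.toReal_ofReal (sq_nonneg _)] at h1
  have h2 := congrArg ENNReal.toReal h
  rw [ENNReal.tsum_toReal_eq (fun i => ENNReal.ofReal_ne_top)] at h2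
  simp only [ENNReal.toReal_ofReal (sq_nonneg _), ENNReal.toReal_one] at h2
  rwa [h2] at h1

lemma norm_le_of_re_inner_le {A : E →L[ℂ] E} (hA : A.IsPositive) {D : ℝ} (hD : 0 ≤ D)
    (h : ∀ x, (⟪x, A x⟫_ℂ).re ≤ D * ‖x‖ ^ 2) : ‖A‖ ≤ D := by
  obtain ⟨S, hS, rfl⟩ := exists_isSelfAdjoint_mul_self_eq hA
  have h1 : ‖S‖ ≤ Real.sqrt D := by
    refine S.opNorm_le_bound (Real.sqrt_nonneg _) fun x => ?_
    have h2 := h x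
    rw [re_inner_mul_self hS] at h2
    rw [← Real.sqrt_sq (norm_nonneg x), ← Real.sqrt_mul hD]
    exact Real.le_sqrt_of_sq_le h2
  calc ‖S * S‖ ≤ ‖S‖ * ‖S‖ := norm_mul_le _ _
    _ ≤ Real.sqrt D * Real.sqrt D := by gcongr
    _ = D := Real.mul_self_sqrt hD

/-- With `A = S²` one has `‖A e‖² ≤ ‖S‖²‖S e‖²` and `‖S‖² = ‖A‖`. -/
lemma posTrace_mul_self_le {A : E →L[ℂ] E} (hA : A.IsPositive) :
    posTrace (A * A) ≤ ENNReal.ofReal ‖A‖ * posTrace A := by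
  obtain ⟨S, hS, rfl⟩ := exists_isSelfAdjoint_mul_self_eq hA
  have hn : ‖S * S‖ = ‖S‖ ^ 2 := hS.norm_mul_self
  unfold posTrace
  rw [← ENNReal.tsum_mul_left]
  refine ENNReal.tsum_le_tsum fun i => ?_
  rw [← ENNReal.ofReal_mul (norm_nonneg _), re_inner_mul_self hA.isSelfAdjoint,
    re_inner_mul_self hS, hn, ← mul_pow]
  refine ENNReal.ofReal_le_ofReal (pow_le_pow_left₀ (norm_nonneg _) ?_ 2)
  exact S.le_opNorm _

lemma hsNorm_sq_of_isPositive {A : E →L[ℂ] E} (hA : A.IsPositive) :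
    hsNorm A ^ 2 = posTrace (A * A) := by
  rw [hsNorm, CFC.abs_of_nonneg A ((nonneg_iff_isPositive A).2 hA), pow_two A,
    ← ENNReal.rpow_natCast, ← ENNReal.rpow_mul]
  norm_num

lemma ofReal_norm_le_hsNorm {A : E →L[ℂ] E} (hA : A.IsPositive) :
    ENNReal.ofReal ‖A‖ ≤ hsNorm A := by
  rcases eq_or_ne (hsNorm A) ∞ with h | h
  · rw [h]
    exact le_top
  have h2 := hsNorm_sq_of_isPositive hA
  refine ENNReal.ofReal_le_of_le_toReal (A.opNorm_le_bound ENNReal.toReal_nonneg fun x => ?_)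
  have hP : (A * A).IsPositive := by
    have := isPositive_adjoint_comp_self A
    rwa [hA.isSelfAdjoint.adjoint_eq] at this
  have h3 := re_inner_le_posTrace hP x
  rw [← h2, re_inner_mul_self hA.isSelfAdjoint, ← ENNReal.ofReal_toReal h,
    ← ENNReal.ofReal_pow ENNReal.toReal_nonneg, ← ENNReal.ofReal_mul (by positivity),
    ENNReal.ofReal_le_ofReal_iff (by positivity), ← mul_pow] at h3
  exact le_of_sq_le_sq h3 (by positivity)

/-- The spectrum lies in `[0, m]`, where `-x ln x ≥ -(ln m) x`. Functional calculus carries this to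
operators, and the trace of the right side is `-ln m`. -/
lemma ofReal_neg_log_le_entropy {A : E →L[ℂ] E} (hA : A.IsPositive) (h1 : posTrace A = 1) {m : ℝ}
    (hm : ‖A‖ ≤ m) : ENNReal.ofReal (-Real.log m) ≤ entropy A := by
  rcases le_or_gt (-Real.log m) 0 with h | h
  · rw [ENNReal.ofReal_of_nonpos h]
    exact zero_le
  have h2 : cfc (fun x : ℝ => -Real.log m * x) A ≤ cfc Real.negMulLog A := by
    refine cfc_mono (fun x hx => ?_) (by fun_prop) Real.continuous_negMulLog.continuousOn
    have hx0 : 0 ≤ x := spectrum_nonneg_of_nonneg ((nonneg_iff_isPositive A).2 hA) hx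
    have hxm : x ≤ m := by
      have h3 := spectrum.norm_le_norm_mul_of_mem hx
      rw [Real.norm_of_nonneg hx0] at h3
      have h4 : ‖(1 : E →L[ℂ] E)‖ ≤ 1 := ContinuousLinearMap.norm_id_le
      exact (h3.trans (mul_le_of_le_one_right (norm_nonneg _) h4)).trans hm
    rw [Real.negMulLog]
    rcases hx0.eq_or_lt with h0 | h0
    · simp [← h0]
    · have := Real.log_le_log h0 hxm
      nlinarith
  rw [cfc_const_mul_id _ _ hA.isSelfAdjoint] at h2
  have h3 := posTrace_mono h2
  rw [← Complex.coe_smul, posTrace_smul h.le, h1, mul_one] at h3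
  exact h3

end PositiveOperators

/-! ### From rank one operators to states -/

section States

variable {n : ℕ} {Λ : ℝ → (StateSpace n →L[ℂ] StateSpace n) → (StateSpace n →L[ℂ] StateSpace n)}
  {t : ℝ}

/-- The quantum diffusion semigroup maps states to operators of norm at most `(2 / t) ^ n`. -/
theorem IsQuantumDiffusionSemigroup.norm_map_le (hΛ : IsQuantumDiffusionSemigroup Λ)
    (ht : 0 < t) {ρ : StateSpace n →L[ℂ] StateSpace n} (hρ : IsState ρ) :
    ‖Λ t ρ‖ ≤ (2 / t) ^ n := by
  have hΛ' := hΛ.toIsQuantumDynamicalSemigroup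
  have hD : 0 ≤ (2 / t) ^ n := by positivity
  refine norm_le_of_re_inner_le (hΛ'.isPositive ht.le hρ.isPositive hρ.isTraceClass) hD fun ψ => ?_
  have hρ1 := hρ.posTrace_eq_one
  obtain ⟨S, hS, hSρ⟩ := exists_isSelfAdjoint_mul_self_eq hρ.isPositive
  have hsum := hasSum_norm_sq_sqrt hS (by rw [hSρ]; exact hρ1)
  set e := onb (StateSpace n)
  -- Split `ρ` into a finite sum of rank one pieces, handled by the kernel bound, and a positive
  -- remainder, handled by its trace `1 - ∑ ‖S eᵢ‖²`. The remainder vanishes in the limit over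
  -- finite sets, so no infinite sum is ever passed through `Λ t`.
  have key : ∀ s : Finset (basisIndex (StateSpace n)), (⟪ψ, Λ t ρ ψ⟫_ℂ).re ≤
      (2 / t) ^ n * ‖ψ‖ ^ 2 + (1 - ∑ i ∈ s, ‖S (e i)‖ ^ 2) * ‖ψ‖ ^ 2 := by
    intro s
    set F := ∑ i ∈ s, InnerProductSpace.rankOne ℂ (S (e i)) (S (e i)) with hF
    have hFfin : IsFiniteRank F := isFiniteRank_sum _ _ fun i _ => isFiniteRank_rankOne _ _
    have hFpos : F.IsPositive := isPositive_sum _ fun i _ =>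
      InnerProductSpace.isPositive_rankOne_self _
    have hR := isPositive_mul_self_sub_sum hS s
    rw [hSρ] at hR
    have htr : posTrace F + posTrace (ρ - F) = 1 := by
      rw [← posTrace_add hFpos hR, add_sub_cancel, hρ1]
    have hRtc : IsTraceClass (ρ - F) := by
      rw [isTraceClass_iff_of_isPositive hR]
      exact lt_of_le_of_lt (le_add_self.trans_eq htr) ENNReal.one_lt_top
    have hFtr : (posTrace F).toReal = ∑ i ∈ s, ‖S (e i)‖ ^ 2 := by
      have : ∀ r : Finset (basisIndex (StateSpace n)), posTrace
          (∑ i ∈ r, InnerProductSpace.rankOne ℂ (S (e i)) (S (e i))) =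
          ∑ i ∈ r, ENNReal.ofReal (‖S (e i)‖ ^ 2) := by
        classical
        intro r
        induction r using Finset.induction_on with
        | empty => simp [posTrace]
        | insert a r ha ih =>
          rw [Finset.sum_insert ha, Finset.sum_insert ha, posTrace_add
            (InnerProductSpace.isPositive_rankOne_self _) (isPositive_sum _ fun i _ =>
            InnerProductSpace.isPositive_rankOne_self _), posTrace_rankOne_self, ih]
      rw [hF, this, ENNReal.toReal_sum fun i _ => ENNReal.ofReal_ne_top]
      simp
    have hRtr : (posTrace (ρ - F)).toReal = 1 - ∑ i ∈ s, ‖S (e i)‖ ^ 2 := by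
      have h1 := congrArg ENNReal.toReal htr
      rw [ENNReal.toReal_add ((isTraceClass_iff_of_isPositive hFpos).1 hFfin.isTraceClass).ne
        ((isTraceClass_iff_of_isPositive hR).1 hRtc).ne, hFtr, ENNReal.toReal_one] at h1
      linarith
    have hsplit : ⟪ψ, Λ t ρ ψ⟫_ℂ = ∑ i ∈ s, evolvedForm Λ t ψ (S (e i)) (S (e i)) +
        ⟪ψ, Λ t (ρ - F) ψ⟫_ℂ := by
      have h1 := hΛ'.map_add t ht.le F (ρ - F) hFfin.isTraceClass hRtc
      rw [add_sub_cancel] at h1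
      rw [h1, add_apply, inner_add_right, hF,
        hΛ'.inner_map_sum ht.le ψ s _ fun i _ => isFiniteRank_rankOne _ _]
      rfl
    have h2 := hΛ'.re_inner_map_le ht.le hR hRtc ψ
    rw [hRtr] at h2
    have h3 : ∑ i ∈ s, (evolvedForm Λ t ψ (S (e i)) (S (e i))).re ≤
        ∑ i ∈ s, (2 / t) ^ n * (‖S (e i)‖ ^ 2 * ‖ψ‖ ^ 2) :=
      Finset.sum_le_sum fun i _ => hΛ.re_evolvedForm_le ht ψ _
    have h4 : ∑ i ∈ s, ‖S (e i)‖ ^ 2 ≤ 1 := sum_le_hasSum s (fun i _ => by positivity) hsum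
    rw [← Finset.mul_sum, ← Finset.sum_mul] at h3
    have h5 : (2 / t) ^ n * ((∑ i ∈ s, ‖S (e i)‖ ^ 2) * ‖ψ‖ ^ 2) ≤ (2 / t) ^ n * (1 * ‖ψ‖ ^ 2) := by
      gcongr
    rw [hsplit, Complex.add_re, Complex.re_sum]
    linarith
  have hlim : Tendsto (fun s : Finset (basisIndex (StateSpace n)) =>
      (2 / t) ^ n * ‖ψ‖ ^ 2 + (1 - ∑ i ∈ s, ‖S (e i)‖ ^ 2) * ‖ψ‖ ^ 2) atTop
      (𝓝 ((2 / t) ^ n * ‖ψ‖ ^ 2 + (1 - 1) * ‖ψ‖ ^ 2)) :=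
    tendsto_const_nhds.add ((tendsto_const_nhds.sub hsum).mul_const _)
  rw [sub_self, zero_mul, add_zero] at hlim
  exact ge_of_tendsto hlim (Eventually.of_forall key)

end States

end

end QuantumDiffusion

open QuantumDiffusion in
theorem theorem4p2 (n : ℕ) (hn : 1 ≤ n) :
    ∃ κ : ℝ, 0 < κ ∧
      ∀ Λ : ℝ → (StateSpace n →L[ℂ] StateSpace n) → (StateSpace n →L[ℂ] StateSpace n),
      IsQuantumDiffusionSemigroup Λ →
      ∀ ρ : StateSpace n →L[ℂ] StateSpace n, IsSchwartzState ρ → HasPositiveWigner ρ →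
      ∀ t : ℝ, 0 < t →
        (ENNReal.ofReal ‖Λ t ρ‖ ≤ hsNorm (Λ t ρ) ∧
          hsNorm (Λ t ρ) ≤ ENNReal.ofReal (κ * t ^ (-(n : ℝ) / 2))) ∧
        (posTrace (Λ t ρ ∘L Λ t ρ) = hsNorm (Λ t ρ) ^ 2 ∧
          posTrace (Λ t ρ ∘L Λ t ρ) ≤ ENNReal.ofReal (κ ^ 2 * t ^ (-(n : ℝ)))) ∧
        (((n : ℝ) / 2 * Real.log (κ ^ (-2 / (n : ℝ)) * t) : ℝ) : EReal) ≤
          (entropy (Λ t ρ) : EReal) := by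
  have hn0 : (n : ℝ) ≠ 0 := by positivity
  -- Chosen so that the square of `κ t^{-n/2}` equals the operator norm bound `(2/t)ⁿ`, which also
  -- bounds the purity because the trace is one.
  refine ⟨2 ^ ((n : ℝ) / 2), by positivity, fun Λ hΛ ρ hρ _ t ht => ?_⟩
  have hΛ' := hΛ.toIsQuantumDynamicalSemigroup
  have hs := hρ.toIsState
  have hP := hΛ'.isPositive ht.le hs.isPositive hs.isTraceClass
  have htr : posTrace (Λ t ρ) = 1 := by
    rw [hΛ'.posTrace_map ht.le hs.isPositive hs.isTraceClass, hs.posTrace_eq_one]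
  have hsq : posTrace (Λ t ρ * Λ t ρ) = hsNorm (Λ t ρ) ^ 2 :=
    (hsNorm_sq_of_isPositive hP).symm
  set m : ℝ := 2 ^ ((n : ℝ) / 2) * t ^ (-(n : ℝ) / 2) with hm
  have hm0 : 0 < m := by positivity
  have hκ2 : ((2 : ℝ) ^ ((n : ℝ) / 2)) ^ 2 = 2 ^ n := by
    rw [← Real.rpow_natCast, ← Real.rpow_mul zero_le_two, Nat.cast_two, div_mul_cancel₀ _ two_ne_zero,
      Real.rpow_natCast]
  have hm2 : m ^ 2 = (2 / t) ^ n := by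
    rw [hm, mul_pow, hκ2, ← Real.rpow_natCast (t ^ _), ← Real.rpow_mul ht.le, Nat.cast_two,
      div_mul_cancel₀ _ two_ne_zero, Real.rpow_neg ht.le, Real.rpow_natCast, div_pow, div_eq_mul_inv]
  have hsq_le : posTrace (Λ t ρ * Λ t ρ) ≤ ENNReal.ofReal (m ^ 2) := by
    refine (posTrace_mul_self_le hP).trans ?_
    rw [htr, mul_one, hm2]
    exact ENNReal.ofReal_le_ofReal (hΛ.norm_map_le ht hs)
  have hhs : hsNorm (Λ t ρ) ≤ ENNReal.ofReal m := by
    rw [hsq, ENNReal.ofReal_pow hm0.le] at hsq_le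
    exact (ENNReal.pow_le_pow_left_iff two_ne_zero).1 hsq_le
  have hle := ofReal_norm_le_hsNorm hP
  refine ⟨⟨hle, hhs⟩, ⟨hsq, ?_⟩, ?_⟩
  · refine hsq_le.trans_eq ?_
    rw [hm2, hκ2, Real.rpow_neg ht.le, Real.rpow_natCast, div_pow, div_eq_mul_inv]
  · have hnm : ‖Λ t ρ‖ ≤ m := (ENNReal.ofReal_le_ofReal_iff hm0.le).1 (hle.trans hhs)
    have hent := ofReal_neg_log_le_entropy hP htr hnm
    -- Both sides equal `(n/2) ln (t/2)`.
    have hlog : (n : ℝ) / 2 * Real.log ((2 ^ ((n : ℝ) / 2)) ^ (-2 / (n : ℝ)) * t) =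
        -Real.log m := by
      rw [hm, Real.log_mul (by positivity) (by positivity), Real.log_mul (by positivity)
        (by positivity), Real.log_rpow (by positivity), Real.log_rpow (by positivity),
        Real.log_rpow ht]
      field_simp
      ring
    rw [hlog]
    refine le_trans ?_ (EReal.coe_ennreal_le_coe_ennreal_iff.2 hent)
    -- `ENNReal.ofReal` truncates at zero, so the lower bound appears as a maximum with `0`.
    rw [EReal.coe_ennreal_ofReal]
    exact EReal.coe_le_coe_iff.2 (le_max_left _ _)
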